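/- Let $\mathbb{H}$ be the algebra of quaternions and let $\mathbb{S}=\{q\in\mathbb{H} : q^2=-1\}$ be the set of its imaginary units. Let $\mathsf{H}\neq\{0\}$ be a quaternionic right Hilbert space: a right $\mathbb{H}$-module with an $\mathbb{H}$-valued Hermitian scalar product $\langle u|v\rangle$, right linear in $v$, with $\langle u|v\rangle=\overline{\langle v|u\rangle}$ and $\langle u|u\rangle=\|u\|^2\ge 0$, complete in the norm $\|\cdot\|$. Let $\mathfrak{B}(\mathsf{H})$ be the set of continuous right $\mathbb{H}$-linear operators on $\mathsf{H}$, with the operator norm and with the adjoint given by $\langle T^*u|v\rangle=\langle u|Tv\rangle$; $T$ is normal if $TT^*=T^*T$, and $T\ge 0$ means that $\langle u|Tu\rangle$ is a non-negative real number for every $u\in\mathsf{H}$. A left scalar multiplication of $\mathsf{H}$ is a map $\mathcal{L}:\mathbb{H}\to\mathfrak{B}(\mathsf{H})$, $q\mapsto L_q$, of the form $L_qu=\sum_{z\in N}zq\langle z|u\rangle$ for some Hilbert basis $N$ of $\mathsf{H}$ (an orthonormal set with $N^\perp=\{0\}$). Fix $\imath\in\mathbb{S}$ and put $\mathbb{C}_\imath^+=\{\alpha+\imath\beta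 : \alpha,\beta\in\mathbb{R},\ \beta\ge 0\}$, with its Borel $\sigma$-algebra $\mathscr{B}(\mathbb{C}_\imath^+)$. A qPVM over $\mathbb{C}_\imath^+$ in $\mathsf{H}$ is a map $P:\mathscr{B}(\mathbb{C}_\imath^+)\to\mathfrak{B}(\mathsf{H})$ with $P(\mathbb{C}_\imath^+)=\mathrm{I}$, $P(E)P(E')=P(E\cap E')$, $P(E)\ge 0$, and $\sum_{n}P(E_n)u=P(\bigcup_nE_n)u$ for every $u\in\mathsf{H}$ and every countable family of pairwise disjoint Borel sets $E_n$. Its support $\Gamma$ is the complement of the union of all open sets $O\subset\mathbb{C}_\imath^+$ with $P(O)=0$. An iqPVM is a pair $(P,\mathcal{L})$ of a qPVM $P$ and a left scalar multiplication $\mathcal{L}$ with $P(E)L_q=L_qP(E)$ for all $E\in\mathscr{B}(\mathbb{C}_\imath^+)$ and $q\in\mathbb{H}$; it is bounded if $\Gamma$ is bounded. For a simple function $s=\sum_\ell S_\ell\chi_{E_\ell}$ (finitely many $S_\ell\in\mathbb{H}$, and $E_\ell$ pairwise disjoint Borel sets) one puts $\int s\,d(P,\mathcal{L})=\sum_\ell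 L_{S_\ell}P(E_\ell)$. For a function $\varphi:\mathbb{C}_\imath^+\to\mathbb{H}$ that is bounded and Borel measurable on $\Gamma$, $\int_{\mathbb{C}_\imath^+}\varphi\,d(P,\mathcal{L})$ is the limit in operator norm of $\int s_n\,d(P,\mathcal{L})$ for any simple functions $s_n$ that converge uniformly on $\mathbb{C}_\imath^+$ to the function equal to $\varphi$ on $\Gamma$ and to $0$ off $\Gamma$. Let $\mathrm{id}:\mathbb{C}_\imath^+\to\mathbb{H}$ be the inclusion. Let $T\in\mathfrak{B}(\mathsf{H})$ be normal, and let $P$ be the qPVM over $\mathbb{C}_\imath^+$ in $\mathsf{H}$ associated with $T$ by the spectral theorem, i.e. the qPVM with bounded support such that $(P,\mathcal{L}^0)$ is an iqPVM with $T=\int_{\mathbb{C}_\imath^+}\mathrm{id}\,d(P,\mathcal{L}^0)$ for some left scalar multiplication $\mathcal{L}^0$ of $\mathsf{H}$. Let $\mathcal{L}:q\mapsto L_q$ be a left scalar multiplication of $\mathsf{H}$. Then $(P,\mathcal{L})$ is an iqPVM over $\mathbb{C}_\imath^+$ in $\mathsf{H}$ with $T=\int_{\mathbb{C}_\imath^+}\mathrm{id}\,d(P,\mathcal{L})$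 if and only if the following three conditions hold: (i) $L_\imath T=TL_\imath$; (ii) $L_\jmath T=T^*L_\jmath$ for some $\jmath\in\mathbb{S}$ with $\imath\jmath=-\jmath\,\imath$; (iii) $-L_\imath(T-T^*)\ge 0$. -/

import Mathlib

open scoped Quaternion RightActions

noncomputable section

namespace QuaternionicSpectral

/-- A quaternionic (right) Hilbert space.  The right scalar multiplication `u q` is the action of
`MulOpposite.op q`, written `u <• q`; the Hermitian quaternionic scalar product `⟨u|v⟩` is
`inner ℍ u v`, it is right linear in the second variable and induces the norm; the space is
complete. -/
class QuaternionicHilbertSpace (H : Type*) [NormedAddCommGroup H] extends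
    Module ℍᵐᵒᵖ H, Inner ℍ H, CompleteSpace H where
  qinner_add_right : ∀ u v w : H, inner u (v + w) = inner u v + inner u w
  qinner_smul_right : ∀ (u v : H) (q : ℍ), inner u (v <• q) = inner u v * q
  qinner_conj_symm : ∀ u v : H, star (inner v u) = inner u v
  qinner_self : ∀ u : H, inner u u = ((‖u‖ ^ 2 : ℝ) : ℍ)

/-- `𝔅(H)`: the continuous right `ℍ`-linear operators on `H`, with composition as product. -/
abbrev BoundedOp (H : Type*) [NormedAddCommGroup H] [QuaternionicHilbertSpace H] : Type _ :=
  H →L[ℍᵐᵒᵖ] H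

section Adjoint

open QuaternionicHilbertSpace

/-- The real vector space underlying a quaternionic Hilbert space: `r u = u r`. -/
abbrev realModule (H : Type*) [NormedAddCommGroup H] [QuaternionicHilbertSpace H] : Module ℝ H :=
  Module.compHom H (algebraMap ℝ ℍᵐᵒᵖ)

variable {H : Type*} [NormedAddCommGroup H] [QuaternionicHilbertSpace H]

theorem qinner_add_left (u v w : H) : inner ℍ (u + v) w = inner ℍ u w + inner ℍ v w := by
  rw [← qinner_conj_symm (u + v) w, ← qinner_conj_symm u w, ← qinner_conj_symm v w,
    qinner_add_right, star_add]

theorem qinner_smul_left (u v : H) (q : ℍ) : inner ℍ (u <• q) v = star q * inner ℍ u v := by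
  rw [← qinner_conj_symm (u <• q) v, ← qinner_conj_symm u v, qinner_smul_right, star_mul]

theorem norm_smul_right (u : H) (q : ℍ) : ‖u <• q‖ = ‖q‖ * ‖u‖ := by
  have h := qinner_self (u <• q)
  rw [qinner_smul_right, qinner_smul_left, qinner_self, mul_assoc, Quaternion.coe_commutes,
    ← mul_assoc, Quaternion.star_mul_self, ← Quaternion.coe_mul, Quaternion.coe_inj,
    Quaternion.normSq_eq_norm_mul_self] at h
  rw [← sq_eq_sq₀ (norm_nonneg _) (by positivity), ← h]
  ring

/-- The real Hilbert space underlying a quaternionic Hilbert space, with scalar product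
`Re ⟨u|v⟩`. -/
abbrev realInnerProductSpace (H : Type*) [NormedAddCommGroup H] [QuaternionicHilbertSpace H] :
    InnerProductSpace ℝ H :=
  letI := realModule H
  have hs : ∀ (r : ℝ) (x : H), r • x = x <• (r : ℍ) := fun _ _ => rfl
  { toModule := realModule H
    norm_smul_le := fun r x => by rw [hs, norm_smul_right, Quaternion.norm_coe]
    inner := fun x y => (inner ℍ x y).re
    norm_sq_eq_re_inner := fun x => by
      rw [qinner_self, Quaternion.re_coe]; rfl
    conj_inner_symm := fun x y => by
      rw [conj_trivial, ← qinner_conj_symm x y, Quaternion.re_star]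
    add_left := fun x y z => by rw [qinner_add_left, Quaternion.re_add]
    smul_left := fun x y r => by
      rw [hs, qinner_smul_left, conj_trivial, Quaternion.star_coe, Quaternion.coe_mul_eq_smul,
        Quaternion.re_smul, smul_eq_mul] }

theorem eq_of_re_mul_eq {a b : ℍ} (h : ∀ q : ℍ, (a * q).re = (b * q).re) : a = b := by
  have h0 := h (star (a - b))
  rw [← sub_eq_zero, ← Quaternion.re_sub, ← sub_mul, Quaternion.self_mul_star,
    Quaternion.re_coe, Quaternion.normSq_eq_zero] at h0
  exact sub_eq_zero.1 h0

theorem eq_of_inner_eq {u v : H} (h : ∀ w : H, inner ℍ u w = inner ℍ v w) : u = v := by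
  have h0 : inner ℍ (u - v) (u - v) = 0 := by
    have := qinner_add_left (u - v) v (u - v)
    rw [sub_add_cancel, h, right_eq_add] at this
    exact this
  rw [qinner_self, ← Quaternion.coe_zero, Quaternion.coe_inj] at h0
  exact sub_eq_zero.1 (norm_eq_zero.1 (pow_eq_zero_iff two_ne_zero |>.1 h0))

theorem exists_adjoint (T : BoundedOp H) :
    ∃ S : BoundedOp H, ∀ u v : H, inner ℍ (S u) v = inner ℍ u (T v) := by
  let _ := realInnerProductSpace H
  let T' : H →L[ℝ] H :=
    { toFun := T
      map_add' := map_add T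
      map_smul' := fun r x => T.map_smul _ x
      cont := T.continuous }
  have hre : ∀ u v : H, (inner ℍ (T'.adjoint u) v).re = (inner ℍ u (T v)).re := fun u v =>
    ContinuousLinearMap.adjoint_inner_left T' v u
  have hq : ∀ u v : H, inner ℍ (T'.adjoint u) v = inner ℍ u (T v) := fun u v => by
    refine eq_of_re_mul_eq fun q => ?_
    rw [← qinner_smul_right, hre, map_smul, qinner_smul_right]
  refine ⟨{ toFun := T'.adjoint, map_add' := map_add _, map_smul' := fun q u => ?_,
            cont := T'.adjoint.continuous }, hq⟩
  refine eq_of_inner_eq fun w => ?_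
  obtain ⟨q, rfl⟩ := MulOpposite.op_surjective q
  rw [hq, RingHom.id_apply, qinner_smul_left, qinner_smul_left, hq]

/-- The adjoint `T*` of `T ∈ 𝔅(H)`. -/
def adjoint (T : BoundedOp H) : BoundedOp H := (exists_adjoint T).choose

theorem adjoint_inner_left (T : BoundedOp H) (u v : H) :
    inner ℍ (adjoint T u) v = inner ℍ u (T v) := (exists_adjoint T).choose_spec u v

/-- `T` is normal. -/
def IsNormal (T : BoundedOp H) : Prop := T * adjoint T = adjoint T * T

/-- `T ≥ 0`: the quaternion `⟨u|Tu⟩` is a non-negative real for every `u`. -/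
def IsPositive (T : BoundedOp H) : Prop :=
  ∀ u : H, ∃ r : ℝ, 0 ≤ r ∧ inner ℍ u (T u) = (r : ℍ)

end Adjoint

/-- The set `𝕊` of imaginary units of `ℍ`. -/
def imaginaryUnits : Set ℍ := {q | q * q = -1}

/-- The closed half plane `ℂ_ι⁺ = {α + ιβ : α, β ∈ ℝ, β ≥ 0}`. -/
def halfPlane (ι : ℍ) : Set ℍ := {q | ∃ α β : ℝ, 0 ≤ β ∧ q = (α : ℍ) + ι * (β : ℍ)}

/-- `ℂ_ι⁺` carries the Borel `σ`-algebra of the topology induced by `ℍ`. -/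
instance halfPlane.measurableSpace (ι : ℍ) : MeasurableSpace (halfPlane ι) := borel _

instance halfPlane.borelSpace (ι : ℍ) : BorelSpace (halfPlane ι) := ⟨rfl⟩

variable {H : Type*} [NormedAddCommGroup H] [QuaternionicHilbertSpace H]

/-- `N` is a Hilbert basis of `H`. -/
structure IsHilbertBasis (N : Set H) : Prop where
  norm_eq_one : ∀ z ∈ N, ‖z‖ = 1
  orthogonal : ∀ z ∈ N, ∀ z' ∈ N, z ≠ z' → inner ℍ z z' = 0
  perp_eq_zero : ∀ u : H, (∀ z ∈ N, inner ℍ u z = 0) → u = 0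

/-- `L : ℍ → 𝔅(H)` is a left scalar multiplication of `H`: it is induced by some Hilbert basis `N`,
`L_q u = ∑_{z ∈ N} z q ⟨z|u⟩`. -/
def IsLeftScalarMul (L : ℍ → BoundedOp H) : Prop :=
  ∃ N : Set H, IsHilbertBasis N ∧
    ∀ (q : ℍ) (u : H), HasSum (fun z : N => ((z : H) <• q) <• inner ℍ (z : H) u) (L q u)

section PVM

variable {ι : ℍ}

/-- `P` is a quaternionic projection-valued measure (qPVM) over `ℂ_ι⁺` in `H`.  Only the values of
`P` at Borel sets matter, here and in all that follows. -/
structure IsQPVM (P : Set (halfPlane ι) → BoundedOp H) : Prop where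
  univ : P Set.univ = 1
  inter : ∀ E E', MeasurableSet E → MeasurableSet E' → P E * P E' = P (E ∩ E')
  sigma_additive : ∀ (N : Set ℕ) (E : N → Set (halfPlane ι)), (∀ n, MeasurableSet (E n)) →
    Pairwise (fun n m => Disjoint (E n) (E m)) →
    ∀ u : H, HasSum (fun n => P (E n) u) (P (⋃ n, E n) u)
  positive : ∀ E, MeasurableSet E → IsPositive (P E)

/-- The support of `P`. -/
def pvmSupport (P : Set (halfPlane ι) → BoundedOp H) : Set (halfPlane ι) :=
  (⋃₀ {O | IsOpen O ∧ P O = 0})ᶜ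

/-- The pair `(P, L)` is an intertwining quaternionic projection-valued measure (iqPVM) over
`ℂ_ι⁺` in `H`. -/
structure IsIQPVM (P : Set (halfPlane ι) → BoundedOp H) (L : ℍ → BoundedOp H) : Prop where
  isQPVM : IsQPVM P
  isLeftScalarMul : IsLeftScalarMul L
  commute : ∀ (E : Set (halfPlane ι)) (q : ℍ), MeasurableSet E → P E * L q = L q * P E

/-- The integral `∑_ℓ L_{S_ℓ} P(E_ℓ)` of a simple function `s = ∑_ℓ S_ℓ χ_{E_ℓ}`. -/
def simpleIntegral (P : Set (halfPlane ι) → BoundedOp H) (L : ℍ → BoundedOp H)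
    (s : MeasureTheory.SimpleFunc (halfPlane ι) ℍ) : BoundedOp H :=
  ∑ q ∈ s.range, L q * P (s ⁻¹' {q})

/-- Convergence in the operator norm of `𝔅(H)`. -/
def TendstoInOpNorm (S : ℕ → BoundedOp H) (T : BoundedOp H) : Prop :=
  ∀ ε : ℝ, 0 < ε → ∃ n₀ : ℕ, ∀ n ≥ n₀, ∀ u : H, ‖S n u - T u‖ ≤ ε * ‖u‖

/-- `T` is the integral over `ℂ_ι⁺` of `φ`, a function that is bounded and measurable on the support
`Γ` of `P`, with respect to `(P, L)`: `T` is the limit in the operator norm of the integrals of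
simple functions that converge uniformly to the function equal to `φ` on `Γ` and to `0` off `Γ`.
(The existence of such simple functions forces `φ` to be bounded and measurable on `Γ`; the
limit does not depend on them.) -/
def HasIntegral (P : Set (halfPlane ι) → BoundedOp H) (L : ℍ → BoundedOp H)
    (φ : halfPlane ι → ℍ) (T : BoundedOp H) : Prop :=
  ∃ s : ℕ → MeasureTheory.SimpleFunc (halfPlane ι) ℍ,
    TendstoUniformly (fun n => ⇑(s n)) ((pvmSupport P).indicator φ) Filter.atTop ∧
    TendstoInOpNorm (fun n => simpleIntegral P L (s n)) T

/-- `P` is the qPVM associated with `T` by the spectral theorem: the unique qPVM that, for some left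
scalar multiplication `L`, is the first component of a bounded iqPVM `(P, L)` with
`T = ∫ id d(P, L)`, where `id : ℂ_ι⁺ → ℍ` is the inclusion map. -/
def IsAssociatedQPVM (P : Set (halfPlane ι) → BoundedOp H) (T : BoundedOp H) : Prop :=
  Bornology.IsBounded (pvmSupport P) ∧
    ∃ L : ℍ → BoundedOp H, IsIQPVM P L ∧ HasIntegral P L (fun z => (z : ℍ)) T

end PVM

end QuaternionicSpectral

end

open QuaternionicSpectral

/-! Everything is transported to the real Hilbert space with scalar product `Re ⟨u|v⟩`. There `P` is
a real projection-valued measure, and a left scalar multiplication is a unital star-homomorphism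
from `ℍ` to the bounded operators. For a fixed simple function `s`, the map `f ↦ specSum P L s f` is
again a star-homomorphism when `L` commutes with `P`, and it does not depend on `L` when `f` is
real-valued. So `T = R + L_ι S`, where `R = (T + T*)/2` and `S = -L_ι (T - T*)/2` are the integrals
of the two real coordinates on the half plane, determined by `P` alone, with `S ≥ 0`.

If `(P, L)` represents `T`, the three conditions are limits of pointwise facts about points `z` of
the half plane: `ι z = z ι`, `j z = star z * j`, and the coefficient of `ι` is non-negative.

Conversely, conditions (i) and (ii) say that `L_ι` and `L_j` commute with `R` and with `(T - T*)²`,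
hence with `S²`. Since the symbol of `S` is non-negative, `R` and `S²` separate the points of the
half plane, so both units commute with every `P(E)` (`commute_pvm`, based on `commute_sublevel`),
and then so does every `L_q`. Finally `-L_ι (T - T*)/2`, formed with the given `L`, is positive by
(iii), commutes with `S` and has the same square; uniqueness of positive square roots
(`eq_of_sq_eq_of_nonneg`) makes it equal to `S`, so `(P, L)` integrates `id` to `R + L_ι S = T`. -/

namespace QuaternionicSpectral

open MeasureTheory Filter Topology QuaternionicHilbertSpace

/-! ### Projection-valued measures on a real Hilbert space and operators commuting with them. -/

section RealPVM

variable {E Ω : Type*} [NormedAddCommGroup E] [InnerProductSpace ℝ E] [CompleteSpace E]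
  [MeasurableSpace Ω]

/-- A projection-valued measure on a real Hilbert space. -/
structure IsRealPVM (P : Set Ω → E →L[ℝ] E) : Prop where
  univ : P Set.univ = 1
  empty : P ∅ = 0
  inter : ∀ A B, MeasurableSet A → MeasurableSet B → P A * P B = P (A ∩ B)
  iUnion : ∀ A : ℕ → Set Ω, (∀ n, MeasurableSet (A n)) →
    Pairwise (fun n m => Disjoint (A n) (A m)) → ∀ u, HasSum (fun n => P (A n) u) (P (⋃ n, A n) u)
  star_eq : ∀ A, MeasurableSet A → star (P A) = P A

namespace IsRealPVM

variable {P : Set Ω → E →L[ℝ] E} (hP : IsRealPVM P)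
include hP

theorem union {A B : Set Ω} (hA : MeasurableSet A) (hB : MeasurableSet B) (hAB : Disjoint A B) :
    P (A ∪ B) = P A + P B := by
  ext u
  -- Additivity is available for sequences only, so the pair is padded with empty sets.
  let S : ℕ → Set Ω := fun n => if n = 0 then A else if n = 1 then B else ∅
  have hS : ∀ n, MeasurableSet (S n) := by
    intro n; simp only [S]; split_ifs <;> simp [hA, hB]
  have hd : Pairwise (fun n m => Disjoint (S n) (S m)) := by
    intro n m hnm
    simp only [S]
    split_ifs <;> first | omega | simp [hAB.symm]
  have hU : ⋃ n, S n = A ∪ B := by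
    ext x
    simp only [Set.mem_iUnion, Set.mem_union, S]
    constructor
    · rintro ⟨n, hn⟩
      split_ifs at hn
      · exact Or.inl hn
      · exact Or.inr hn
      · exact hn.elim
    · rintro (h | h)
      · exact ⟨0, by simpa using h⟩
      · exact ⟨1, by simpa using h⟩
  have h1 := hP.iUnion S hS hd u
  rw [hU] at h1
  have h2 : HasSum (fun n => P (S n) u) (∑ n ∈ Finset.range 2, P (S n) u) := by
    refine hasSum_sum_of_ne_finset_zero fun n hn => ?_
    have : S n = ∅ := by
      simp only [Finset.mem_range, not_lt] at hn
      simp only [S]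
      rw [if_neg (by omega), if_neg (by omega)]
    rw [this, hP.empty]; rfl
  rw [h1.unique h2]
  simp [Finset.sum_range_succ, S]

theorem compl {A : Set Ω} (hA : MeasurableSet A) : P Aᶜ = 1 - P A := by
  have := hP.union hA hA.compl disjoint_compl_right
  rw [Set.union_compl_self, hP.univ] at this
  rw [this, add_sub_cancel_left]

theorem biUnion_finset {κ : Type*} (t : Finset κ) (A : κ → Set Ω) (hA : ∀ k, MeasurableSet (A k))
    (hd : Pairwise (fun n m => Disjoint (A n) (A m))) :
    P (⋃ k ∈ t, A k) = ∑ k ∈ t, P (A k) := by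
  classical
  induction t using Finset.induction_on with
  | empty => simp [hP.empty]
  | insert a t ha ih =>
    rw [Finset.set_biUnion_insert, Finset.sum_insert ha, ← ih]
    refine hP.union (hA a) (Finset.measurableSet_biUnion _ fun k _ => hA k) ?_
    rw [Set.disjoint_iUnion₂_right]
    intro k hk
    exact hd (fun h => ha (h ▸ hk))

/-- Disjointify the family: the projection of each smaller set factors through `P (A n)`, hence
still kills `u`, and additivity applies. -/
theorem iUnion_apply_eq_zero (A : ℕ → Set Ω) (hA : ∀ n, MeasurableSet (A n)) (u : E)
    (h0 : ∀ n, P (A n) u = 0) : P (⋃ n, A n) u = 0 := by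
  have hm : ∀ n, MeasurableSet (disjointed A n) := fun n => MeasurableSet.disjointed hA n
  have h := hP.iUnion (disjointed A) hm (disjoint_disjointed A) u
  rw [iUnion_disjointed] at h
  refine h.unique ?_
  convert hasSum_zero with n
  have : P (disjointed A n) = P (disjointed A n) * P (A n) := by
    rw [hP.inter _ _ (hm n) (hA n), Set.inter_eq_left.2 (disjointed_subset A n)]
  rw [this, mul_apply_eq_comp, h0, map_zero]

theorem commute {A B : Set Ω} (hA : MeasurableSet A) (hB : MeasurableSet B) :
    Commute (P A) (P B) := by
  rw [Commute, SemiconjBy, hP.inter _ _ hA hB, hP.inter _ _ hB hA, Set.inter_comm]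

theorem inner_self {A : Set Ω} (hA : MeasurableSet A) (u : E) :
    inner ℝ u (P A u) = ‖P A u‖ ^ 2 := by
  have h := ContinuousLinearMap.adjoint_inner_left (P A) (P A u) u
  rw [← ContinuousLinearMap.star_eq_adjoint, hP.star_eq A hA, real_inner_self_eq_norm_sq] at h
  rw [h, ← mul_apply_eq_comp, hP.inter _ _ hA hA, Set.inter_self]

theorem eq_zero_of_subset {A B : Set Ω} (hA : MeasurableSet A) (hB : MeasurableSet B)
    (hAB : A ⊆ B) (h : P B = 0) : P A = 0 := by
  rw [← Set.inter_eq_left.2 hAB, ← hP.inter _ _ hA hB, h, mul_zero]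

/-- The complement of the support is a null set. -/
theorem sUnion_open_eq_zero [TopologicalSpace Ω] [SecondCountableTopology Ω] [BorelSpace Ω] :
    P (⋃₀ {O | IsOpen O ∧ P O = 0}) = 0 := by
  -- The family of open null sets may be uncountable; second countability extracts a countable
  -- subfamily with the same union.
  obtain ⟨S, hSc, hSs, hSU⟩ := TopologicalSpace.isOpen_sUnion_countable
    {O | IsOpen O ∧ P O = 0} (fun O hO => hO.1)
  rw [← hSU]
  rcases S.eq_empty_or_nonempty with rfl | hne
  · simp [hP.empty]
  · obtain ⟨f, rfl⟩ := hSc.exists_eq_range hne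
    rw [Set.sUnion_range]
    ext u
    refine hP.iUnion_apply_eq_zero f (fun n => (hSs ⟨n, rfl⟩).1.measurableSet) u fun n => ?_
    rw [(hSs ⟨n, rfl⟩).2]; rfl

/-- The `σ`-algebra of the measurable sets whose projection commutes with `X`. -/
@[reducible] def commutingSigmaAlgebra (X : E →L[ℝ] E) : MeasurableSpace Ω :=
  MeasurableSpace.DynkinSystem.toMeasurableSpace
    { Has := fun A => MeasurableSet A ∧ Commute (P A) X
      has_empty := ⟨MeasurableSet.empty, by rw [hP.empty]; exact Commute.zero_left _⟩
      has_compl := fun {A} h => ⟨h.1.compl, by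
        rw [hP.compl h.1]; exact (Commute.one_left _).sub_left h.2⟩
      has_iUnion_nat := fun {A} hd h => ⟨MeasurableSet.iUnion fun n => (h n).1, by
        ext u
        have h1 := hP.iUnion A (fun n => (h n).1) hd (X u)
        have h2 := (hP.iUnion A (fun n => (h n).1) hd u).mapL X
        have h3 : ∀ n, X (P (A n) u) = P (A n) (X u) := fun n =>
          (DFunLike.congr_fun (h n).2.eq u).symm
        simp only [h3] at h2
        exact h1.unique h2⟩ }
    fun A B hA hB => ⟨hA.1.inter hB.1, by
      rw [← hP.inter _ _ hA.1 hB.1]; exact hA.2.mul_left hB.2⟩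

theorem measurableSet_commutingSigmaAlgebra {X : E →L[ℝ] E} {A : Set Ω} :
    MeasurableSet[hP.commutingSigmaAlgebra X] A ↔ MeasurableSet A ∧ Commute (P A) X := Iff.rfl

/-- If `X` commutes with `G`, and `G` is small on the range of `P A` and large on the range of
`P B`, then `X` has no component from the first range to the second. -/
theorem mul_mul_eq_zero {A B : Set Ω} (hA : MeasurableSet A) (hB : MeasurableSet B)
    {G X : E →L[ℝ] E} (hX : Commute G X) (hGA : Commute G (P A)) (hGB : Commute G (P B))
    {r t : ℝ} (hr : 0 ≤ r) (hrt : r < t) (hup : ∀ u, ‖G (P A u)‖ ≤ r * ‖P A u‖)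
    (hlow : ∀ u, t * ‖P B u‖ ≤ ‖G (P B u)‖) : P B * X * P A = 0 := by
  set Y := P B * X * P A with hY
  have hGY : G * Y = Y * G := by
    rw [hY]
    exact ((hGB.mul_right hX).mul_right hGA).eq
  have hYA : Y * P A = Y := by rw [hY, mul_assoc, hP.inter _ _ hA hA, Set.inter_self]
  have hBY : P B * Y = Y := by
    rw [hY, ← mul_assoc, ← mul_assoc, hP.inter _ _ hB hB, Set.inter_self]
  have hPn : ∀ u, ‖P A u‖ ≤ ‖u‖ := by
    intro u
    have h1 := hP.inner_self hA u
    have h2 := real_inner_le_norm u (P A u)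
    by_contra h
    push Not at h
    nlinarith [norm_nonneg u, norm_nonneg (P A u)]
  -- `Y` intertwines `G` with itself, maps into the range of `P B` and factors through `P A`.
  -- Evaluating `G Y = Y G` with the lower bound on the left and the upper bound on the right gives
  -- `t ‖Y‖ ≤ r ‖Y‖`, so `Y = 0` because `r < t`.
  have key : ∀ u, t * ‖Y u‖ ≤ r * ‖Y‖ * ‖u‖ := by
    intro u
    have e1 : P B (Y u) = Y u := DFunLike.congr_fun hBY u
    have e2 : Y (P A (G u)) = Y (G u) := DFunLike.congr_fun hYA (G u)
    have e3 : G (Y u) = Y (G u) := DFunLike.congr_fun hGY u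
    have e4 : G (P A u) = P A (G u) := DFunLike.congr_fun hGA.eq u
    have h1 := hlow (Y u)
    rw [e1, e3, ← e2, ← e4] at h1
    calc t * ‖Y u‖ ≤ _ := h1
      _ ≤ ‖Y‖ * ‖G (P A u)‖ := Y.le_opNorm _
      _ ≤ ‖Y‖ * (r * ‖u‖) := by
        gcongr
        exact (hup u).trans (by gcongr; exact hPn u)
      _ = r * ‖Y‖ * ‖u‖ := by ring
  have ht : 0 < t := hr.trans_lt hrt
  have hn : ‖Y‖ ≤ r / t * ‖Y‖ := by
    refine Y.opNorm_le_bound (by positivity) fun u => ?_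
    have := key u
    rw [div_mul_eq_mul_div, div_mul_eq_mul_div, le_div_iff₀ ht]
    linarith
  have hlt : r / t < 1 := (div_lt_one ht).2 hrt
  have : ‖Y‖ = 0 := by nlinarith [norm_nonneg Y]
  exact norm_eq_zero.1 this

/-- An anti-self-adjoint operator that commutes with `G` commutes with the spectral projection of
a sublevel set `{g ≤ r}`, where `g ≥ 0` stands for the modulus of the symbol of `G`. -/
theorem commute_sublevel {g : Ω → ℝ} (hg : Measurable g) {G X : E →L[ℝ] E} (hX : Commute G X)
    (hXs : star X = -X) (hGP : ∀ A, MeasurableSet A → Commute G (P A))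
    {φ : ℝ → ℝ} (hφ0 : ∀ r, 0 ≤ r → 0 ≤ φ r) (hφ : ∀ r t, 0 ≤ r → r < t → φ r < φ t)
    {r : ℝ} (hr : 0 ≤ r)
    (hup : ∀ u, ‖G (P {x | g x ≤ r} u)‖ ≤ φ r * ‖P {x | g x ≤ r} u‖)
    (hlow : ∀ t, r < t → ∀ u, φ t * ‖P {x | t ≤ g x} u‖ ≤ ‖G (P {x | t ≤ g x} u)‖) :
    Commute (P {x | g x ≤ r}) X := by
  set A := {x | g x ≤ r} with hAdef
  have hA : MeasurableSet A := measurableSet_le hg measurable_const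
  have hcA : P Aᶜ * X * P A = 0 := by
    -- Each of these sets is separated from the sublevel set by a positive gap, as `mul_mul_eq_zero`
    -- requires; the complement itself is not.
    have hU : Aᶜ = ⋃ n : ℕ, {x | r + 1 / ((n : ℝ) + 1) ≤ g x} := by
      ext x
      simp only [hAdef, Set.mem_compl_iff, Set.mem_ofPred_eq, not_le, Set.mem_iUnion]
      constructor
      · intro h
        obtain ⟨n, hn⟩ := exists_nat_one_div_lt (sub_pos.2 h)
        exact ⟨n, by linarith⟩
      · rintro ⟨n, hn⟩
        have : (0 : ℝ) < 1 / ((n : ℝ) + 1) := by positivity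
        linarith
    ext u
    rw [mul_assoc, mul_apply_eq_comp, hU]
    refine hP.iUnion_apply_eq_zero _ (fun n => measurableSet_le measurable_const hg) _ fun n => ?_
    have hlt : r < r + 1 / ((n : ℝ) + 1) := lt_add_of_pos_right _ (by positivity)
    have hB : MeasurableSet {x | r + 1 / ((n : ℝ) + 1) ≤ g x} := measurableSet_le measurable_const hg
    exact DFunLike.congr_fun (hP.mul_mul_eq_zero hA hB hX (hGP _ hA) (hGP _ hB) (hφ0 r hr)
      (hφ _ _ hr hlt) hup (hlow _ hlt)) u
  have h1 : X * P A = P A * X * P A := by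
    rw [hP.compl hA, sub_mul, sub_mul, one_mul, sub_eq_zero] at hcA
    exact hcA
  -- One off-diagonal block of `X` vanishes; anti-self-adjointness transfers this to the other
  -- block.
  have h2 := congrArg star h1
  rw [star_mul, star_mul, star_mul, hXs, hP.star_eq A hA] at h2
  have h3 : P A * X = P A * X * P A := by
    rw [mul_neg, neg_mul, mul_neg, neg_inj] at h2
    rw [mul_assoc]
    exact h2
  rw [Commute, SemiconjBy, h1]
  exact h3

end IsRealPVM

/-- The sum `∑_q L_{f(q)} P(s⁻¹(q))`: the integral of `f ∘ s`, for a simple function `s`. -/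
noncomputable def specSum (P : Set Ω → E →L[ℝ] E) (L : ℍ →⋆ₐ[ℝ] (E →L[ℝ] E)) (s : SimpleFunc Ω ℍ)
    (f : ℍ → ℍ) : E →L[ℝ] E :=
  ∑ q ∈ s.range, L (f q) * P (s ⁻¹' {q})

/-! ### Functional calculus of a simple function. -/

section SpecSum

variable {P : Set Ω → E →L[ℝ] E} (hP : IsRealPVM P) {L : ℍ →⋆ₐ[ℝ] (E →L[ℝ] E)}
  (hL : ∀ A, MeasurableSet A → ∀ q, Commute (L q) (P A)) (s : SimpleFunc Ω ℍ)

theorem specSum_add (f g : ℍ → ℍ) :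
    specSum P L s (fun q => f q + g q) = specSum P L s f + specSum P L s g := by
  simp [specSum, add_mul, Finset.sum_add_distrib]

theorem specSum_sub (f g : ℍ → ℍ) :
    specSum P L s (fun q => f q - g q) = specSum P L s f - specSum P L s g := by
  simp [specSum, sub_mul, Finset.sum_sub_distrib]

theorem specSum_const_mul (c : ℍ) (f : ℍ → ℍ) :
    specSum P L s (fun q => c * f q) = L c * specSum P L s f := by
  simp [specSum, Finset.mul_sum, mul_assoc]

include hL in
theorem specSum_mul_const (c : ℍ) (f : ℍ → ℍ) :
    specSum P L s (fun q => f q * c) = specSum P L s f * L c := by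
  simp only [specSum, Finset.sum_mul, map_mul]
  refine Finset.sum_congr rfl fun q _ => ?_
  rw [mul_assoc, mul_assoc, (hL _ (s.measurableSet_fiber q) c).eq]

include hP hL in
theorem specSum_star (f : ℍ → ℍ) :
    specSum P L s (fun q => star (f q)) = star (specSum P L s f) := by
  simp only [specSum, star_sum, star_mul, map_star]
  refine Finset.sum_congr rfl fun q _ => ?_
  rw [hP.star_eq _ (s.measurableSet_fiber q), ← map_star,
    (hL _ (s.measurableSet_fiber q) _).eq]

include hP in
theorem sum_fiber : ∑ q ∈ s.range, P (s ⁻¹' {q}) = 1 := by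
  rw [← hP.univ, ← hP.biUnion_finset _ _ (fun q => s.measurableSet_fiber q)]
  · congr 1
    ext x
    simp
  · intro q q' hqq
    exact Disjoint.preimage _ (by simpa using hqq)

include hP hL in
-- Distinct fibres are disjoint, so the cross terms vanish; the commutation of `L` with `P` brings
-- the coefficients together on the diagonal.
theorem specSum_mul (f g : ℍ → ℍ) :
    specSum P L s (fun q => f q * g q) = specSum P L s f * specSum P L s g := by
  simp only [specSum, Finset.sum_mul_sum]
  refine Finset.sum_congr rfl fun q hq => ?_
  rw [Finset.sum_eq_single q]
  · rw [map_mul, mul_assoc (L (f q)), mul_assoc (L (f q)), ← mul_assoc (P _),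
      ← (hL _ (s.measurableSet_fiber q) _).eq, mul_assoc (L (g q)), hP.inter _ _
      (s.measurableSet_fiber q) (s.measurableSet_fiber q), Set.inter_self]
  · intro q' _ hne
    have h0 : P (s ⁻¹' {q}) * P (s ⁻¹' {q'}) = 0 := by
      rw [hP.inter _ _ (s.measurableSet_fiber q) (s.measurableSet_fiber q'),
        ← Set.preimage_inter]
      rw [Set.singleton_inter_eq_empty.2 (by simpa using hne.symm), Set.preimage_empty, hP.empty]
    rw [mul_assoc (L (f q)), ← mul_assoc (P _), ← (hL _ (s.measurableSet_fiber q) _).eq,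
      mul_assoc (L (g q')), h0, mul_zero, mul_zero]
  · exact fun h => (h hq).elim

include hP in
theorem specSum_const (c : ℍ) : specSum P L s (fun _ => c) = L c := by
  rw [specSum, ← Finset.mul_sum, sum_fiber hP, mul_one]

include hP hL in
theorem specSum_commute (f : ℍ → ℍ) {A : Set Ω} (hA : MeasurableSet A) :
    Commute (specSum P L s f) (P A) :=
  Commute.sum_left _ _ _ fun q _ => (hL A hA _).mul_left (hP.commute (s.measurableSet_fiber q) hA)

theorem map_coe_eq_smul (r : ℝ) : L (r : ℍ) = r • (1 : E →L[ℝ] E) := by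
  have : (r : ℍ) = algebraMap ℝ ℍ r := rfl
  rw [this, AlgHomClass.commutes, Algebra.algebraMap_eq_smul_one]

include hP in
theorem inner_specSum_coe (b : ℍ → ℝ) (u : E) :
    inner ℝ u (specSum P L s (fun q => (b q : ℍ)) u) =
      ∑ q ∈ s.range, b q * ‖P (s ⁻¹' {q}) u‖ ^ 2 := by
  simp only [specSum, map_coe_eq_smul, smul_mul_assoc, one_mul,
    sum_apply, smul_apply, inner_sum, inner_smul_right]
  exact Finset.sum_congr rfl fun q _ => by rw [hP.inner_self (s.measurableSet_fiber q)]

include hP hL in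
-- The sum for `star f * f` is the adjoint of the sum for `f` times that sum, and `star f * f` is
-- real-valued, so its quadratic form is explicit.
theorem norm_specSum_sq (f : ℍ → ℍ) (u : E) :
    ‖specSum P L s f u‖ ^ 2 = ∑ q ∈ s.range, ‖f q‖ ^ 2 * ‖P (s ⁻¹' {q}) u‖ ^ 2 := by
  rw [← inner_specSum_coe hP (L := L)]
  have : ∀ q, ((‖f q‖ ^ 2 : ℝ) : ℍ) = star (f q) * f q := fun q => by
    rw [Quaternion.star_mul_self, Quaternion.normSq_eq_norm_mul_self, sq]
  simp only [this]
  rw [specSum_mul hP hL, specSum_star hP hL, mul_apply_eq_comp,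
    ContinuousLinearMap.star_eq_adjoint, ContinuousLinearMap.adjoint_inner_right,
    real_inner_self_eq_norm_sq]

include hP in
theorem norm_sq_eq_sum_fiber (u : E) : ‖u‖ ^ 2 = ∑ q ∈ s.range, ‖P (s ⁻¹' {q}) u‖ ^ 2 := by
  have h := sum_fiber hP s
  have h1 := congrArg (fun S : E →L[ℝ] E => inner ℝ u (S u)) h
  simp only [sum_apply, inner_sum, one_apply_eq_self,
    real_inner_self_eq_norm_sq] at h1
  rw [← h1]
  exact Finset.sum_congr rfl fun q _ => by rw [hP.inner_self (s.measurableSet_fiber q)]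

include hP in
-- Such a fibre meets `A` only inside the null set `Γᶜ`. Hence norm bounds on the range of `P A`
-- need control of the symbol only at points of `A ∩ Γ`.
theorem fiber_apply_eq_zero {Γ A : Set Ω} (hΓm : MeasurableSet Γ) (hΓ : P Γᶜ = 0)
    (hA : MeasurableSet A) {q : ℍ} (h : ¬ ∃ x ∈ A ∩ Γ, s x = q) (u : E) :
    P (s ⁻¹' {q}) (P A u) = 0 := by
  rw [← mul_apply_eq_comp, hP.inter _ _ (s.measurableSet_fiber q) hA,
    hP.eq_zero_of_subset ((s.measurableSet_fiber q).inter hA) hΓm.compl _ hΓ]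
  · rfl
  · rintro x ⟨h1, h2⟩ h3
    exact h ⟨x, ⟨h2, h3⟩, h1⟩

include hP hL in
theorem norm_specSum_le {Γ A : Set Ω} (hΓm : MeasurableSet Γ) (hΓ : P Γᶜ = 0)
    (hA : MeasurableSet A) {f : ℍ → ℍ} {M : ℝ} (hM : 0 ≤ M)
    (h : ∀ x ∈ A ∩ Γ, ‖f (s x)‖ ≤ M) (u : E) :
    ‖specSum P L s f (P A u)‖ ≤ M * ‖P A u‖ := by
  refine le_of_sq_le_sq ?_ (by positivity)
  rw [mul_pow, norm_specSum_sq hP hL, norm_sq_eq_sum_fiber hP s, Finset.mul_sum]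
  refine Finset.sum_le_sum fun q _ => ?_
  by_cases hq : ∃ x ∈ A ∩ Γ, s x = q
  · obtain ⟨x, hx, rfl⟩ := hq
    have := h x hx
    gcongr
  · rw [fiber_apply_eq_zero hP s hΓm hΓ hA hq]; simp

include hP hL in
theorem le_norm_specSum {Γ A : Set Ω} (hΓm : MeasurableSet Γ) (hΓ : P Γᶜ = 0)
    (hA : MeasurableSet A) {f : ℍ → ℍ} {M : ℝ}
    (h : ∀ x ∈ A ∩ Γ, M ≤ ‖f (s x)‖) (u : E) :
    M * ‖P A u‖ ≤ ‖specSum P L s f (P A u)‖ := by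
  rcases lt_or_ge M 0 with hM | hM
  · exact (mul_nonpos_of_nonpos_of_nonneg hM.le (norm_nonneg _)).trans (norm_nonneg _)
  refine le_of_sq_le_sq ?_ (by positivity)
  rw [mul_pow, norm_specSum_sq hP hL, norm_sq_eq_sum_fiber hP s, Finset.mul_sum]
  refine Finset.sum_le_sum fun q _ => ?_
  by_cases hq : ∃ x ∈ A ∩ Γ, s x = q
  · obtain ⟨x, hx, rfl⟩ := hq
    have := h x hx
    gcongr
  · rw [fiber_apply_eq_zero hP s hΓm hΓ hA hq]; simp

include hP hL in
theorem opNorm_specSum_le {f : ℍ → ℍ} {M : ℝ} (hM : 0 ≤ M) (h : ∀ x, ‖f (s x)‖ ≤ M) :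
    ‖specSum P L s f‖ ≤ M := by
  refine ContinuousLinearMap.opNorm_le_bound _ hM fun u => ?_
  have := norm_specSum_le hP hL s (Γ := Set.univ) (A := Set.univ) MeasurableSet.univ
    (by simp [hP.empty]) MeasurableSet.univ hM (fun x _ => h x) u
  rwa [hP.univ] at this

end SpecSum

end RealPVM

/-- Two commuting positive operators with the same square coincide. -/
theorem eq_of_sq_eq_of_nonneg {E : Type*} [NormedAddCommGroup E] [InnerProductSpace ℝ E]
    [CompleteSpace E] {A B : E →L[ℝ] E} (hA : star A = A) (hB : star B = B)
    (hA0 : ∀ u, 0 ≤ inner ℝ u (A u)) (hB0 : ∀ u, 0 ≤ inner ℝ u (B u)) (hAB : Commute A B)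
    (h : A * A = B * B) : A = B := by
  have hsym : ∀ {S : E →L[ℝ] E}, star S = S → ∀ u v, inner ℝ (S u) v = inner ℝ u (S v) := by
    intro S hS u v
    have := ContinuousLinearMap.adjoint_inner_left S v u
    rwa [← ContinuousLinearMap.star_eq_adjoint, hS] at this
  -- A non-negative quadratic form vanishes only on its kernel: otherwise moving from `w` slightly
  -- in the direction `-S w` makes it negative.
  have hker : ∀ {S : E →L[ℝ] E}, star S = S → (∀ u, 0 ≤ inner ℝ u (S u)) →
      ∀ w, inner ℝ w (S w) = 0 → S w = 0 := by
    intro S hS hS0 w hw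
    by_contra hne
    have hpos : 0 < ‖S w‖ ^ 2 := by positivity
    set c := inner ℝ (S w) (S (S w))
    have hc : 0 ≤ c := hS0 _
    have hq : ∀ t : ℝ, 0 ≤ 2 * t * ‖S w‖ ^ 2 + t ^ 2 * c := by
      intro t
      have := hS0 (w + t • S w)
      rw [map_add, map_smul, inner_add_left, inner_add_right, inner_add_right, inner_smul_left,
        inner_smul_left, inner_smul_right, inner_smul_right, hw, ← hsym hS w (S w),
        real_inner_self_eq_norm_sq, conj_trivial] at this
      change 0 ≤ 0 + t * ‖S w‖ ^ 2 + (t * ‖S w‖ ^ 2 + t * (t * c)) at this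
      linarith
    -- The minimum of the quadratic polynomial is at `-‖S w‖ ^ 2 / c`; using `c + 1` also covers `c
    -- = 0`.
    have h1 := hq (-(‖S w‖ ^ 2 / (c + 1)))
    have h2 : 2 * (-(‖S w‖ ^ 2 / (c + 1))) * ‖S w‖ ^ 2 + (-(‖S w‖ ^ 2 / (c + 1))) ^ 2 * c
        = -((‖S w‖ ^ 2) ^ 2 * (c + 2) / (c + 1) ^ 2) := by
      field_simp
      ring
    rw [h2] at h1
    have : 0 < (‖S w‖ ^ 2) ^ 2 * (c + 2) / (c + 1) ^ 2 := by positivity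
    linarith
  ext u
  -- Since `(A + B) w = 0`, the two non-negative forms at `w` sum to zero, so `A w = B w = 0`, and
  -- then `‖w‖² = ⟨u, (A - B) w⟩ = 0`.
  set w := (A - B) u with hw
  have h0 : (A + B) w = 0 := by
    have : (A + B) * (A - B) = 0 := by
      rw [add_mul, mul_sub, mul_sub, h, hAB.eq]; abel
    exact DFunLike.congr_fun this u
  have h1 : inner ℝ w (A w) + inner ℝ w (B w) = 0 := by
    rw [← inner_add_right, ← add_apply, h0, inner_zero_right]
  have hAw := hker hA hA0 w (by linarith [hA0 w, hB0 w])
  have hBw := hker hB hB0 w (by linarith [hA0 w, hB0 w])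
  have h2 : inner ℝ w w = 0 := by
    nth_rw 1 [hw]
    rw [hsym (S := A - B) (by rw [star_sub, hA, hB]), sub_apply, hAw, hBw,
      sub_zero, inner_zero_right]
  have : w = 0 := inner_self_eq_zero.1 h2
  rw [hw, sub_apply, sub_eq_zero] at this
  exact this

/-! ### Algebra of imaginary units in the quaternions. -/

section ImaginaryUnits

theorem re_eq_zero_of_mem_imaginaryUnits {ι : ℍ} (hι : ι ∈ imaginaryUnits) : ι.re = 0 := by
  have h : ι * ι = -1 := hι
  have h0 := congrArg (·.re) h
  have h1 := congrArg (·.imI) h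
  have h2 := congrArg (·.imJ) h
  have h3 := congrArg (·.imK) h
  simp at h0 h1 h2 h3
  by_contra hne
  have e1 : ι.imI = 0 := by
    have : ι.re * ι.imI = 0 := by linarith
    exact (mul_eq_zero.1 this).resolve_left hne
  have e2 : ι.imJ = 0 := by
    have : ι.re * ι.imJ = 0 := by linarith
    exact (mul_eq_zero.1 this).resolve_left hne
  have e3 : ι.imK = 0 := by
    have : ι.re * ι.imK = 0 := by linarith
    exact (mul_eq_zero.1 this).resolve_left hne
  rw [e1, e2, e3] at h0
  nlinarith [sq_nonneg ι.re]

theorem star_eq_neg_of_mem_imaginaryUnits {ι : ℍ} (hι : ι ∈ imaginaryUnits) : star ι = -ι := by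
  have := re_eq_zero_of_mem_imaginaryUnits hι
  ext <;> simp [this]

theorem norm_eq_one_of_mem_imaginaryUnits {ι : ℍ} (hι : ι ∈ imaginaryUnits) : ‖ι‖ = 1 := by
  have h : ι * ι = -1 := hι
  have h1 := congrArg norm h
  rw [norm_mul, norm_neg, norm_one] at h1
  nlinarith [norm_nonneg ι]

theorem sq_add_sq_of_mem_imaginaryUnits {ι : ℍ} (hι : ι ∈ imaginaryUnits) :
    ι.imI ^ 2 + ι.imJ ^ 2 + ι.imK ^ 2 = 1 := by
  have h : ι * ι = -1 := hι
  have h0 := congrArg (·.re) h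
  simp [re_eq_zero_of_mem_imaginaryUnits hι] at h0
  linarith

theorem mem_imaginaryUnits_of_sq {j : ℍ} (h0 : j.re = 0)
    (h : j.imI ^ 2 + j.imJ ^ 2 + j.imK ^ 2 = 1) : j ∈ imaginaryUnits := by
  change j * j = -1
  ext
  · simp [h0]; linarith
  · simp [h0]; ring
  · simp [h0]; ring
  · simp [h0]; ring

theorem exists_anticommuting_unit {ι : ℍ} (hι : ι ∈ imaginaryUnits) :
    ∃ j ∈ imaginaryUnits, ι * j = -(j * ι) := by
  have h0 := re_eq_zero_of_mem_imaginaryUnits hι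
  have key : ∀ a b : ℝ, a ^ 2 + b ^ 2 = 1 → a * ι.imI + b * ι.imJ = 0 →
      ∃ j ∈ imaginaryUnits, ι * j = -(j * ι) := by
    -- Imaginary units anticommute exactly when they are orthogonal in `ℝ³`; a unit vector
    -- orthogonal to `ι` is sought in the plane of the first two coordinates.
    intro a b h1 h2
    obtain ⟨j, j0, j1, j2, j3⟩ : ∃ j : ℍ, j.re = 0 ∧ j.imI = a ∧ j.imJ = b ∧ j.imK = 0 :=
      ⟨⟨0, a, b, 0⟩, rfl, rfl, rfl, rfl⟩
    refine ⟨j, mem_imaginaryUnits_of_sq j0 (by rw [j1, j2, j3]; linarith), ?_⟩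
    ext
    · simp [h0, j0, j1, j2, j3]; linarith
    · simp [h0, j0, j1, j2, j3]; ring
    · simp [h0, j0, j1, j2, j3]; ring
    · simp [h0, j0, j1, j2, j3]; ring
  by_cases h : ι.imI ^ 2 + ι.imJ ^ 2 = 0
  · have e1 : ι.imI = 0 := by nlinarith [sq_nonneg ι.imI, sq_nonneg ι.imJ]
    exact key 1 0 (by norm_num) (by rw [e1]; ring)
  · have hpos : 0 < ι.imI ^ 2 + ι.imJ ^ 2 := lt_of_le_of_ne (by positivity) (Ne.symm h)
    set r := Real.sqrt (ι.imI ^ 2 + ι.imJ ^ 2)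
    have hr2 : r ^ 2 = ι.imI ^ 2 + ι.imJ ^ 2 := Real.sq_sqrt hpos.le
    have hr0 : r ≠ 0 := (Real.sqrt_pos.2 hpos).ne'
    refine key (ι.imJ / r) (-(ι.imI / r)) ?_ (by ring)
    field_simp
    linarith

theorem eq_of_commute_imaginaryUnit {ι p : ℍ} (hι : ι ∈ imaginaryUnits) (h : ι * p = p * ι) :
    ∃ x y : ℝ, p = (x : ℍ) + ι * (y : ℍ) := by
  have h0 := re_eq_zero_of_mem_imaginaryUnits hι
  have hs := sq_add_sq_of_mem_imaginaryUnits hι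
  have h1 := congrArg (·.imI) h
  have h2 := congrArg (·.imJ) h
  have h3 := congrArg (·.imK) h
  simp [h0] at h1 h2 h3
  -- The commutator is twice the cross product of the imaginary parts, so that of `p` is parallel to
  -- the unit vector `ι`, with the scalar product as coefficient.
  refine ⟨p.re, ι.imI * p.imI + ι.imJ * p.imJ + ι.imK * p.imK, ?_⟩
  ext
  · simp [h0]
  · simp [h0]
    linear_combination (-p.imI) * hs - ι.imJ / 2 * h3 + ι.imK / 2 * h2
  · simp [h0]
    linear_combination (-p.imJ) * hs + ι.imI / 2 * h3 - ι.imK / 2 * h1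
  · simp [h0]
    linear_combination (-p.imK) * hs - ι.imI / 2 * h2 + ι.imJ / 2 * h1

/-- Every quaternion is `z + w j` with `z, w ∈ ℝ + ι ℝ`. -/
theorem exists_eq_add_mul {ι j : ℍ} (hι : ι ∈ imaginaryUnits) (hj : j ∈ imaginaryUnits)
    (hij : ι * j = -(j * ι)) (q : ℍ) :
    ∃ x y z w : ℝ, q = ((x : ℍ) + ι * (y : ℍ)) + ((z : ℍ) + ι * (w : ℍ)) * j := by
  have hi2 : ι * ι = -1 := hι
  have hj2 : j * j = -1 := hj
  -- For `q = a + b j` with `a`, `b` commuting with `ι`, one has `ι q ι = -a + b j`. So `q - ι q ι =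
  -- 2a`, while `(q + ι q ι) j = -2b`, which explains the signs of the witnesses below.
  obtain ⟨x, y, h1⟩ := eq_of_commute_imaginaryUnit (p := q - ι * q * ι) hι (by
    simp only [mul_sub, sub_mul, ← mul_assoc, hi2]
    rw [mul_assoc (ι * q), hi2]
    simp only [neg_mul, one_mul, mul_neg, mul_one]
    abel)
  obtain ⟨z, w, h2⟩ := eq_of_commute_imaginaryUnit (p := (q + ι * q * ι) * j) hι (by
    have e : (q + ι * q * ι) * j * ι = -((q + ι * q * ι) * ι * j) := by
      rw [mul_assoc _ j ι, mul_assoc _ ι j, hij, mul_neg, neg_neg]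
    rw [e, ← mul_assoc, ← neg_mul]
    congr 1
    simp only [mul_add, add_mul, ← mul_assoc, hi2]
    rw [mul_assoc (ι * q), hi2]
    simp only [neg_mul, one_mul, mul_neg, mul_one]
    abel)
  have h3 : q + ι * q * ι = -(((z : ℍ) + ι * (w : ℍ)) * j) := by
    rw [← h2, mul_assoc _ j j, hj2, mul_neg, mul_one, neg_neg]
  refine ⟨2⁻¹ * x, 2⁻¹ * y, -(2⁻¹ * z), -(2⁻¹ * w), ?_⟩
  have h4 : q = (2⁻¹ : ℝ) • ((q - ι * q * ι) + (q + ι * q * ι)) := by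
    rw [sub_add_add_cancel, ← two_smul ℝ q, smul_smul]; norm_num
  rw [h4, h1, h3]
  simp only [Quaternion.coe_neg, ← Quaternion.smul_coe, mul_neg, neg_mul, add_mul, mul_smul_comm,
    smul_mul_assoc]
  module

end ImaginaryUnits

/-! ### A Lipschitz retraction of the quaternions onto the half plane. -/

section Retraction

theorem abs_re_le_norm (q : ℍ) : |q.re| ≤ ‖q‖ := by
  refine abs_le_of_sq_le_sq ?_ (norm_nonneg q)
  rw [sq ‖q‖, ← Quaternion.normSq_eq_norm_mul_self, Quaternion.normSq_def']
  nlinarith [sq_nonneg q.imI, sq_nonneg q.imJ, sq_nonneg q.imK]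

/-- The non-negative part of the coefficient of `ι`. -/
noncomputable def imPart (ι q : ℍ) : ℝ := max (-(ι * q).re) 0

/-- A Lipschitz retraction of `ℍ` onto `ℂ_ι⁺`. -/
noncomputable def retraction (ι q : ℍ) : ℍ := (q.re : ℍ) + ι * (imPart ι q : ℍ)

variable {ι : ℍ}

theorem imPart_nonneg (q : ℍ) : 0 ≤ imPart ι q := le_max_right _ _

theorem abs_re_sub_re_le (p q : ℍ) : |p.re - q.re| ≤ ‖p - q‖ := by
  rw [← Quaternion.re_sub]; exact abs_re_le_norm _

theorem abs_imPart_sub_le (hι : ι ∈ imaginaryUnits) (p q : ℍ) :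
    |imPart ι p - imPart ι q| ≤ ‖p - q‖ := by
  have h : |(ι * q).re - (ι * p).re| ≤ ‖p - q‖ := by
    rw [abs_sub_comm, ← Quaternion.re_sub, ← mul_sub]
    refine (abs_re_le_norm _).trans ?_
    rw [norm_mul, norm_eq_one_of_mem_imaginaryUnits hι, one_mul]
  unfold imPart
  refine (abs_max_sub_max_le_abs _ _ _).trans ?_
  rwa [neg_sub_neg]

theorem norm_retraction_sub_le (hι : ι ∈ imaginaryUnits) (p q : ℍ) :
    ‖retraction ι p - retraction ι q‖ ≤ 2 * ‖p - q‖ := by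
  have : retraction ι p - retraction ι q =
      ((p.re - q.re : ℝ) : ℍ) + ι * ((imPart ι p - imPart ι q : ℝ) : ℍ) := by
    simp only [retraction, Quaternion.coe_sub, mul_sub]; abel
  rw [this]
  refine (norm_add_le _ _).trans ?_
  rw [norm_mul, norm_eq_one_of_mem_imaginaryUnits hι, one_mul, Quaternion.norm_coe,
    Quaternion.norm_coe, two_mul]
  exact add_le_add (abs_re_sub_re_le p q) (abs_imPart_sub_le hι p q)

theorem retraction_eq_self (hι : ι ∈ imaginaryUnits) {x : ℍ} (hx : x ∈ halfPlane ι) :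
    retraction ι x = x := by
  obtain ⟨α, β, hβ, rfl⟩ := hx
  have h0 := re_eq_zero_of_mem_imaginaryUnits hι
  have hi : ι * ((α : ℍ) + ι * (β : ℍ)) = ι * (α : ℍ) - (β : ℍ) := by
    rw [mul_add, ← mul_assoc, show ι * ι = -1 from hι, neg_one_mul, sub_eq_add_neg]
  have h1 : imPart ι ((α : ℍ) + ι * (β : ℍ)) = β := by
    rw [imPart, hi]
    simp [h0, hβ]
  rw [retraction, h1]
  simp [h0]

theorem commute_retraction (q : ℍ) : ι * retraction ι q = retraction ι q * ι := by
  rw [retraction, mul_add, add_mul, Quaternion.coe_commutes, mul_assoc, Quaternion.coe_commutes]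

theorem mul_retraction (hι : ι ∈ imaginaryUnits) {j : ℍ} (hij : ι * j = -(j * ι)) (q : ℍ) :
    j * retraction ι q = star (retraction ι q) * j := by
  rw [retraction, star_add, star_mul, Quaternion.star_coe, Quaternion.star_coe,
    star_eq_neg_of_mem_imaginaryUnits hι, mul_add, add_mul, Quaternion.coe_commutes, mul_neg,
    neg_mul, mul_assoc, hij, mul_neg, neg_neg, Quaternion.coe_commutes, ← mul_assoc]

end Retraction

/-! ### Limits of simple integrals and the real coordinates of the operator. -/

section HalfPlane

variable {E : Type*} [NormedAddCommGroup E] [InnerProductSpace ℝ E] [CompleteSpace E]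
  {ι : ℍ} {P : Set (halfPlane ι) → E →L[ℝ] E} {L : ℍ →⋆ₐ[ℝ] (E →L[ℝ] E)}
  {s : ℕ → SimpleFunc (halfPlane ι) ℍ} {Γ : Set (halfPlane ι)} {T : E →L[ℝ] E}

theorem zero_mem_halfPlane : (0 : ℍ) ∈ halfPlane ι := ⟨0, 0, le_rfl, by simp⟩

theorem indicator_coe_mem_halfPlane (x : halfPlane ι) :
    Γ.indicator (fun z => (z : ℍ)) x ∈ halfPlane ι := by
  by_cases hx : x ∈ Γ
  · rw [Set.indicator_of_mem hx]; exact x.2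
  · rw [Set.indicator_of_notMem hx]; exact zero_mem_halfPlane

/-- Approximating simple functions may take values off the half plane, where the needed commutation
identities fail. The retraction is 2-Lipschitz and fixes the limit function, so composing with it
moves `s n` by at most three times its distance to the limit. -/
theorem tendsto_specSum_sub_retraction (hι : ι ∈ imaginaryUnits) (hP : IsRealPVM P)
    (hL : ∀ A, MeasurableSet A → ∀ q, Commute (L q) (P A))
    (hs : TendstoUniformly (fun n => ⇑(s n)) (Γ.indicator fun z => (z : ℍ)) atTop) :
    Tendsto (fun n => specSum P L (s n) id - specSum P L (s n) (retraction ι)) atTop (𝓝 0) := by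
  rw [Metric.tendsto_nhds]
  intro ε hε
  filter_upwards [Metric.tendstoUniformly_iff.1 hs (ε / 6) (by positivity)] with n hn
  rw [dist_zero_right]
  refine lt_of_le_of_lt (b := ε / 2) ?_ (by linarith)
  rw [← specSum_sub]
  refine opNorm_specSum_le hP hL _ (by positivity) fun x => ?_
  set y := Γ.indicator (fun z => (z : ℍ)) x
  have h1 : ‖s n x - y‖ ≤ ε / 6 := by
    have := hn x
    rw [dist_comm, dist_eq_norm] at this
    exact this.le
  have h2 := norm_retraction_sub_le hι y (s n x)
  rw [retraction_eq_self hι (indicator_coe_mem_halfPlane x)] at h2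
  have h3 := norm_sub_rev y (s n x)
  calc ‖id (s n x) - retraction ι (s n x)‖ = ‖(s n x - y) + (y - retraction ι (s n x))‖ := by
        rw [sub_add_sub_cancel]; rfl
    _ ≤ _ := norm_add_le _ _
    _ ≤ ε / 2 := by linarith

variable (P L) in
theorem specSum_retraction (t : SimpleFunc (halfPlane ι) ℍ) :
    specSum P L t (retraction ι) = specSum P L t (fun q => (q.re : ℍ)) +
      L ι * specSum P L t (fun q => (imPart ι q : ℍ)) := by
  rw [← specSum_const_mul, ← specSum_add]; rfl

theorem star_specSum_coe (hP : IsRealPVM P)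
    (hL : ∀ A, MeasurableSet A → ∀ q, Commute (L q) (P A)) (t : SimpleFunc (halfPlane ι) ℍ)
    (b : ℍ → ℝ) :
    star (specSum P L t (fun q => (b q : ℍ))) = specSum P L t (fun q => (b q : ℍ)) := by
  rw [← specSum_star hP hL]
  simp only [Quaternion.star_coe]

theorem commute_specSum_coe (hL : ∀ A, MeasurableSet A → ∀ q, Commute (L q) (P A))
    (t : SimpleFunc (halfPlane ι) ℍ) (b : ℍ → ℝ) (q : ℍ) :
    Commute (L q) (specSum P L t (fun q => (b q : ℍ))) := by
  rw [Commute, SemiconjBy, ← specSum_const_mul, ← specSum_mul_const hL]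
  simp only [Quaternion.coe_commutes]

theorem map_mul_self_of_mem_imaginaryUnits (hι : ι ∈ imaginaryUnits) : L ι * L ι = -1 := by
  rw [← map_mul, show ι * ι = -1 from hι, map_neg, map_one]

theorem star_map_of_mem_imaginaryUnits (hι : ι ∈ imaginaryUnits) : star (L ι) = -L ι := by
  rw [← map_star, star_eq_neg_of_mem_imaginaryUnits hι, map_neg]

theorem star_specSum_retraction (hι : ι ∈ imaginaryUnits) (hP : IsRealPVM P)
    (hL : ∀ A, MeasurableSet A → ∀ q, Commute (L q) (P A)) (t : SimpleFunc (halfPlane ι) ℍ) :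
    star (specSum P L t (retraction ι)) = specSum P L t (fun q => (q.re : ℍ)) -
      L ι * specSum P L t (fun q => (imPart ι q : ℍ)) := by
  rw [specSum_retraction, star_add, star_mul, star_specSum_coe hP hL,
    star_specSum_coe hP hL, star_map_of_mem_imaginaryUnits hι,
    (commute_specSum_coe hL t (imPart ι) ι).eq, mul_neg, sub_eq_add_neg]

theorem tendsto_specSum_re (hι : ι ∈ imaginaryUnits) (hP : IsRealPVM P)
    (hL : ∀ A, MeasurableSet A → ∀ q, Commute (L q) (P A))
    (hT : Tendsto (fun n => specSum P L (s n) (retraction ι)) atTop (𝓝 T)) :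
    Tendsto (fun n => specSum P L (s n) (fun q => (q.re : ℍ))) atTop
      (𝓝 ((2⁻¹ : ℝ) • (T + star T))) := by
  refine ((hT.add hT.star).const_smul (2⁻¹ : ℝ)).congr fun n => ?_
  rw [star_specSum_retraction hι hP hL, specSum_retraction, add_add_sub_cancel, ← two_smul ℝ,
    smul_smul]
  norm_num

/-- This identifies `-L_ι (T - T*)/2` as the integral of a non-negative real function, which is
where condition (iii) comes from. -/
theorem tendsto_specSum_imPart (hι : ι ∈ imaginaryUnits) (hP : IsRealPVM P)
    (hL : ∀ A, MeasurableSet A → ∀ q, Commute (L q) (P A))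
    (hT : Tendsto (fun n => specSum P L (s n) (retraction ι)) atTop (𝓝 T)) :
    Tendsto (fun n => specSum P L (s n) (fun q => (imPart ι q : ℍ))) atTop
      (𝓝 ((2⁻¹ : ℝ) • -(L ι * (T - star T)))) := by
  refine (((hT.sub hT.star).const_mul (L ι)).neg.const_smul (2⁻¹ : ℝ)).congr fun n => ?_
  rw [star_specSum_retraction hι hP hL, specSum_retraction, add_sub_sub_cancel, mul_add,
    ← mul_assoc, map_mul_self_of_mem_imaginaryUnits hι, neg_one_mul, neg_add, neg_neg,
    ← two_smul ℝ, smul_smul]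
  norm_num

theorem commute_of_tendsto_retraction
    (hL : ∀ A, MeasurableSet A → ∀ q, Commute (L q) (P A))
    (hT : Tendsto (fun n => specSum P L (s n) (retraction ι)) atTop (𝓝 T)) :
    L ι * T = T * L ι := by
  refine tendsto_nhds_unique (hT.const_mul (L ι)) ((hT.mul_const (L ι)).congr fun n => ?_)
  rw [← specSum_mul_const hL, ← specSum_const_mul]
  simp only [commute_retraction]

theorem mul_eq_star_mul_of_tendsto_retraction (hι : ι ∈ imaginaryUnits) (hP : IsRealPVM P)
    (hL : ∀ A, MeasurableSet A → ∀ q, Commute (L q) (P A))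
    (hT : Tendsto (fun n => specSum P L (s n) (retraction ι)) atTop (𝓝 T))
    {j : ℍ} (hij : ι * j = -(j * ι)) : L j * T = star T * L j := by
  refine tendsto_nhds_unique (hT.const_mul (L j)) ((hT.star.mul_const (L j)).congr fun n => ?_)
  rw [← specSum_star hP hL, ← specSum_mul_const hL, ← specSum_const_mul]
  simp only [mul_retraction hι hij]

theorem inner_nonneg_of_tendsto_retraction (hι : ι ∈ imaginaryUnits) (hP : IsRealPVM P)
    (hL : ∀ A, MeasurableSet A → ∀ q, Commute (L q) (P A))
    (hT : Tendsto (fun n => specSum P L (s n) (retraction ι)) atTop (𝓝 T)) (u : E) :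
    0 ≤ inner ℝ u ((-(L ι * (T - star T))) u) := by
  have h := tendsto_specSum_imPart hι hP hL hT
  have h1 : Tendsto (fun n => inner ℝ u (specSum P L (s n) (fun q => (imPart ι q : ℍ)) u)) atTop
      (𝓝 (inner ℝ u (((2⁻¹ : ℝ) • -(L ι * (T - star T))) u))) :=
    tendsto_const_nhds.inner (((ContinuousLinearMap.apply ℝ E u).continuous.tendsto _).comp h)
  have h2 := ge_of_tendsto' h1 fun n => by
    rw [inner_specSum_coe hP]
    exact Finset.sum_nonneg fun q _ => mul_nonneg (imPart_nonneg q) (sq_nonneg _)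
  rw [smul_apply, inner_smul_right] at h2
  linarith

theorem mul_star_of_commute {X : E →L[ℝ] E} (hX : star X = -X) (h : X * T = T * X) :
    X * star T = star T * X := by
  have := congrArg star h
  rw [star_mul, star_mul, hX, mul_neg, neg_mul, neg_inj] at this
  exact this.symm

theorem star_neg_mul_sub_star {X : E →L[ℝ] E} (hX : star X = -X) (h : X * T = T * X) :
    star (-(X * (T - star T))) = -(X * (T - star T)) := by
  rw [star_neg, star_mul, star_sub, star_star, hX, mul_neg, sub_mul, mul_sub, h,
    mul_star_of_commute hX h]
  abel

/-! ### Norm bounds on spectral subspaces for limits of real symbols. -/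

section Bounds

variable {G : E →L[ℝ] E} {f : ℍ → ℝ}

/-- On `Γ` the values of `s n` are eventually within `ε` of the point itself, so a 1-Lipschitz
symbol is bounded by `M + ε` on `A ∩ Γ`; then `ε → 0`. -/
theorem norm_apply_le_of_tendsto (hP : IsRealPVM P)
    (hL : ∀ A, MeasurableSet A → ∀ q, Commute (L q) (P A)) (hΓm : MeasurableSet Γ)
    (hΓ : P Γᶜ = 0)
    (hs : TendstoUniformly (fun n => ⇑(s n)) (Γ.indicator fun z => (z : ℍ)) atTop)
    (hG : Tendsto (fun n => specSum P L (s n) (fun q => (f q : ℍ))) atTop (𝓝 G))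
    (hf : ∀ p q, |f p - f q| ≤ ‖p - q‖) {A : Set (halfPlane ι)} (hA : MeasurableSet A)
    {M : ℝ} (hM : 0 ≤ M) (h : ∀ x ∈ A, |f x| ≤ M) (u : E) : ‖G (P A u)‖ ≤ M * ‖P A u‖ := by
  have hlim : Tendsto (fun n => ‖specSum P L (s n) (fun q => (f q : ℍ)) (P A u)‖) atTop
      (𝓝 ‖G (P A u)‖) :=
    (((ContinuousLinearMap.apply ℝ E (P A u)).continuous.tendsto _).comp hG).norm
  have hb : ∀ ε : ℝ, 0 < ε → ‖G (P A u)‖ ≤ (M + ε) * ‖P A u‖ := by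
    intro ε hε
    refine le_of_tendsto hlim ?_
    filter_upwards [Metric.tendstoUniformly_iff.1 hs ε hε] with n hn
    refine norm_specSum_le hP hL _ hΓm hΓ hA (by positivity) (fun x hx => ?_) u
    have h1 := hn x
    rw [Set.indicator_of_mem hx.2, dist_comm, dist_eq_norm] at h1
    rw [Quaternion.norm_coe, Real.norm_eq_abs]
    have h2 := hf (s n x) x
    have h3 := h x hx.1
    have h4 := abs_sub_abs_le_abs_sub (f (s n x)) (f x)
    linarith
  have hc : Tendsto (fun ε : ℝ => (M + ε) * ‖P A u‖) (𝓝[>] 0) (𝓝 ((M + 0) * ‖P A u‖)) := by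
    refine Tendsto.mono_left ?_ nhdsWithin_le_nhds
    exact (Continuous.tendsto (by fun_prop) 0)
  rw [add_zero] at hc
  exact ge_of_tendsto hc (eventually_mem_nhdsWithin.mono fun ε hε => hb ε hε)

theorem le_norm_apply_of_tendsto (hP : IsRealPVM P)
    (hL : ∀ A, MeasurableSet A → ∀ q, Commute (L q) (P A)) (hΓm : MeasurableSet Γ)
    (hΓ : P Γᶜ = 0)
    (hs : TendstoUniformly (fun n => ⇑(s n)) (Γ.indicator fun z => (z : ℍ)) atTop)
    (hG : Tendsto (fun n => specSum P L (s n) (fun q => (f q : ℍ))) atTop (𝓝 G))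
    (hf : ∀ p q, |f p - f q| ≤ ‖p - q‖) {A : Set (halfPlane ι)} (hA : MeasurableSet A)
    {M : ℝ} (h : ∀ x ∈ A, M ≤ |f x|) (u : E) : M * ‖P A u‖ ≤ ‖G (P A u)‖ := by
  have hlim : Tendsto (fun n => ‖specSum P L (s n) (fun q => (f q : ℍ)) (P A u)‖) atTop
      (𝓝 ‖G (P A u)‖) :=
    (((ContinuousLinearMap.apply ℝ E (P A u)).continuous.tendsto _).comp hG).norm
  have hb : ∀ ε : ℝ, 0 < ε → (M - ε) * ‖P A u‖ ≤ ‖G (P A u)‖ := by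
    intro ε hε
    refine ge_of_tendsto hlim ?_
    filter_upwards [Metric.tendstoUniformly_iff.1 hs ε hε] with n hn
    refine le_norm_specSum hP hL _ hΓm hΓ hA (fun x hx => ?_) u
    have h1 := hn x
    rw [Set.indicator_of_mem hx.2, dist_comm, dist_eq_norm] at h1
    rw [Quaternion.norm_coe, Real.norm_eq_abs]
    have h2 := hf (s n x) x
    have h3 := h x hx.1
    have h4 := abs_sub_abs_le_abs_sub (f x) (f (s n x))
    rw [abs_sub_comm] at h4
    linarith
  have hc : Tendsto (fun ε : ℝ => (M - ε) * ‖P A u‖) (𝓝[>] 0) (𝓝 ((M - 0) * ‖P A u‖)) := by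
    refine Tendsto.mono_left ?_ nhdsWithin_le_nhds
    exact (Continuous.tendsto (by fun_prop) 0)
  rw [sub_zero] at hc
  exact le_of_tendsto hc (eventually_mem_nhdsWithin.mono fun ε hε => hb ε hε)

theorem commute_of_tendsto_specSum (hP : IsRealPVM P)
    (hL : ∀ A, MeasurableSet A → ∀ q, Commute (L q) (P A)) {f : ℍ → ℍ}
    (hG : Tendsto (fun n => specSum P L (s n) f) atTop (𝓝 G)) {A : Set (halfPlane ι)}
    (hA : MeasurableSet A) : Commute G (P A) :=
  tendsto_nhds_unique (hG.mul_const (P A)) ((hG.const_mul (P A)).congr fun n =>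
    (specSum_commute hP hL (s n) f hA).eq.symm)

end Bounds

theorem continuous_imPart : Continuous (imPart ι) := by
  unfold imPart
  have : Continuous fun q : ℍ => (ι * q).re :=
    Quaternion.continuous_re.comp (continuous_const.mul continuous_id)
  exact this.neg.max continuous_const

/-- A `σ`-algebra for which both coordinates are measurable contains all Borel sets. -/
theorem measurableSpace_le_of_measurable (hι : ι ∈ imaginaryUnits)
    (m : MeasurableSpace (halfPlane ι))
    (h1 : @Measurable _ _ m _ fun x : halfPlane ι => (x : ℍ).re)
    (h2 : @Measurable _ _ m _ fun x : halfPlane ι => imPart ι x) :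
    halfPlane.measurableSpace ι ≤ m := by
  let _ : MeasurableSpace ℍ := borel ℍ
  have : BorelSpace ℍ := ⟨rfl⟩
  have hF : Continuous fun p : ℝ × ℝ => (p.1 : ℍ) + ι * (p.2 : ℍ) :=
    (Quaternion.continuous_coe.comp continuous_fst).add
      (continuous_const.mul (Quaternion.continuous_coe.comp continuous_snd))
  have hm : @Measurable _ _ m _ fun x : halfPlane ι => (x : ℍ) := by
    have h := @Measurable.comp _ _ _ m _ _ _ _ hF.measurable (h1.prodMk h2)
    convert h using 1
    ext1 x
    exact (retraction_eq_self hι x.2).symm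
  have e : halfPlane.measurableSpace ι = (borel ℍ).comap (fun x : halfPlane ι => (x : ℍ)) :=
    borel_comap
  rw [e]
  exact hm.comap_le

/-- An anti-self-adjoint operator that commutes with the real part of `T` and with the square of its
imaginary part commutes with the projection-valued measure of `T`. -/
theorem commute_pvm (hι : ι ∈ imaginaryUnits) (hP : IsRealPVM P)
    (hL : ∀ A, MeasurableSet A → ∀ q, Commute (L q) (P A)) (hΓm : MeasurableSet Γ)
    (hΓ : P Γᶜ = 0)
    (hs : TendstoUniformly (fun n => ⇑(s n)) (Γ.indicator fun z => (z : ℍ)) atTop)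
    {R S : E →L[ℝ] E}
    (hR : Tendsto (fun n => specSum P L (s n) (fun q => (q.re : ℍ))) atTop (𝓝 R))
    (hS : Tendsto (fun n => specSum P L (s n) (fun q => (imPart ι q : ℍ))) atTop (𝓝 S))
    {X : E →L[ℝ] E} (hX : star X = -X) (hXR : Commute R X) (hXS : Commute (S * S) X)
    {A : Set (halfPlane ι)} (hA : MeasurableSet A) : Commute (P A) X := by
  have hre : Continuous fun x : halfPlane ι => (x : ℍ).re :=
    Quaternion.continuous_re.comp continuous_subtype_val
  have him : Continuous fun x : halfPlane ι => imPart ι x :=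
    continuous_imPart.comp continuous_subtype_val
  have hSP : ∀ B, MeasurableSet B → Commute S (P B) := fun B hB =>
    commute_of_tendsto_specSum hP hL hS hB
  refine (measurableSpace_le_of_measurable hι (hP.commutingSigmaAlgebra X) ?_ ?_ A hA).2
  -- A closed interval is a sublevel set of the distance to its midpoint, so `commute_sublevel`
  -- applies to `R` shifted by that midpoint.
  · rw [BorelSpace.measurable_eq (α := ℝ), borel_eq_generateFrom_Icc ℝ]
    refine @measurable_generateFrom _ _ (hP.commutingSigmaAlgebra X) _ _ ?_
    rintro _ ⟨a, b, hab, rfl⟩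
    have hlim : Tendsto (fun n => specSum P L (s n)
        (fun q => ((q.re - (a + b) / 2 : ℝ) : ℍ))) atTop (𝓝 (R - L (((a + b) / 2 : ℝ) : ℍ))) := by
      refine (hR.sub_const _).congr fun n => ?_
      rw [← specSum_const hP (s n), ← specSum_sub]
      simp only [Quaternion.coe_sub]
    have hlip : ∀ p q : ℍ, |(p.re - (a + b) / 2) - (q.re - (a + b) / 2)| ≤ ‖p - q‖ := by
      intro p q
      rw [sub_sub_sub_cancel_right]; exact abs_re_sub_re_le p q
    have hg : Measurable fun x : halfPlane ι => |(x : ℍ).re - (a + b) / 2| :=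
      (hre.sub continuous_const).abs.measurable
    have hset : (fun x : halfPlane ι => (x : ℍ).re) ⁻¹' Set.Icc a b =
        {x : halfPlane ι | |(x : ℍ).re - (a + b) / 2| ≤ (b - a) / 2} := by
      ext x
      simp only [Set.mem_preimage, Set.mem_Icc, Set.mem_ofPred_eq, abs_le]
      constructor
      · rintro ⟨h1, h2⟩; constructor <;> linarith
      · rintro ⟨h1, h2⟩; constructor <;> linarith
    rw [hset, hP.measurableSet_commutingSigmaAlgebra]
    have hr : 0 ≤ (b - a) / 2 := by linarith
    refine ⟨measurableSet_le hg measurable_const, ?_⟩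
    refine hP.commute_sublevel hg (G := R - L (((a + b) / 2 : ℝ) : ℍ)) (φ := id) ?_ hX
      (fun B hB => commute_of_tendsto_specSum hP hL hlim hB) (fun r hr => hr)
      (fun r t _ h => h) hr ?_ ?_
    · refine hXR.sub_left ?_
      rw [map_coe_eq_smul]
      exact (Commute.one_left X).smul_left _
    · exact norm_apply_le_of_tendsto hP hL hΓm hΓ hs hlim hlip (measurableSet_le hg measurable_const)
        hr fun x hx => hx
    · exact fun t _ => le_norm_apply_of_tendsto hP hL hΓm hΓ hs hlim hlip
        (measurableSet_le measurable_const hg) fun x hx => hx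
  · refine @measurable_of_Iic _ _ _ _ _ (hP.commutingSigmaAlgebra X) _ _ _ _ fun r => ?_
    rw [hP.measurableSet_commutingSigmaAlgebra]
    refine ⟨him.measurable measurableSet_Iic, ?_⟩
    rcases lt_or_ge r 0 with hr | hr
    · have : (fun x : halfPlane ι => imPart ι x) ⁻¹' Set.Iic r = ∅ := by
        ext x
        simp only [Set.mem_preimage, Set.mem_Iic, Set.mem_empty_iff_false, iff_false, not_le]
        exact hr.trans_le (imPart_nonneg _)
      rw [this, hP.empty]
      exact Commute.zero_left X
    -- Only `S²` is known to commute with `X`. Because `imPart` is non-negative, its sublevel sets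
    -- are also those of its square, so the bounds hold with `φ r = r * r`.
    · refine hP.commute_sublevel (g := fun x => imPart ι x) him.measurable (G := S * S)
        (φ := fun r => r * r) hXS hX (fun B hB => (hSP B hB).mul_left (hSP B hB))
        (fun r _ => mul_self_nonneg r) (fun r t h1 h2 => mul_self_lt_mul_self h1 h2) hr ?_ ?_
      · intro u
        have hB : MeasurableSet {x : halfPlane ι | imPart ι x ≤ r} := him.measurable measurableSet_Iic
        have hb := norm_apply_le_of_tendsto hP hL hΓm hΓ hs hS (abs_imPart_sub_le hι) hB hr
          (fun x hx => by rw [abs_of_nonneg (imPart_nonneg _)]; exact hx)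
        have e : ∀ v, S (P {x : halfPlane ι | imPart ι x ≤ r} v) =
          P {x : halfPlane ι | imPart ι x ≤ r} (S v) := DFunLike.congr_fun (hSP _ hB).eq
        calc ‖(S * S) (P {x : halfPlane ι | imPart ι x ≤ r} u)‖
            = ‖S (P {x : halfPlane ι | imPart ι x ≤ r} (S u))‖ := by
              rw [mul_apply_eq_comp, e]
          _ ≤ r * ‖S (P {x : halfPlane ι | imPart ι x ≤ r} u)‖ := by
              rw [e u]; exact hb _
          _ ≤ r * (r * ‖P {x : halfPlane ι | imPart ι x ≤ r} u‖) := by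
              gcongr; exact hb u
          _ = _ := by ring
      · intro t ht u
        have hB : MeasurableSet {x : halfPlane ι | t ≤ imPart ι x} := him.measurable measurableSet_Ici
        have hb := le_norm_apply_of_tendsto hP hL hΓm hΓ hs hS (abs_imPart_sub_le hι) hB (M := t)
          (fun x hx => by rw [abs_of_nonneg (imPart_nonneg _)]; exact hx)
        have ht0 : 0 ≤ t := hr.trans ht.le
        have e : ∀ v, S (P {x : halfPlane ι | t ≤ imPart ι x} v) =
          P {x : halfPlane ι | t ≤ imPart ι x} (S v) := DFunLike.congr_fun (hSP _ hB).eq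
        calc t * t * ‖P {x : halfPlane ι | t ≤ imPart ι x} u‖
            = t * (t * ‖P {x : halfPlane ι | t ≤ imPart ι x} u‖) := by ring
          _ ≤ t * ‖S (P {x : halfPlane ι | t ≤ imPart ι x} u)‖ := by
              gcongr; exact hb u
          _ ≤ ‖S (P {x : halfPlane ι | t ≤ imPart ι x} (S u))‖ := by
              rw [e u]; exact hb _
          _ = _ := by rw [mul_apply_eq_comp, e u]

/-- Every left scalar multiplication acts on real numbers by ordinary scaling; this is what allows
two of them to be compared through `P`. -/
theorem specSum_coe_eq {L' : ℍ →⋆ₐ[ℝ] (E →L[ℝ] E)} (t : SimpleFunc (halfPlane ι) ℍ) (b : ℍ → ℝ) :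
    specSum P L t (fun q => (b q : ℍ)) = specSum P L' t (fun q => (b q : ℍ)) := by
  simp only [specSum, map_coe_eq_smul]

/-! ### From the three conditions to commutation and integration. -/

section Converse

variable {L' : ℍ →⋆ₐ[ℝ] (E →L[ℝ] E)}

/-- The square forgets `X`. Hence `S²` is expressed through `T` alone, and the candidates for `S`
built from two left multiplications have equal squares. -/
theorem neg_mul_sub_star_sq {X : E →L[ℝ] E} (hX : star X = -X) (hXX : X * X = -1)
    (h : X * T = T * X) :
    -(X * (T - star T)) * -(X * (T - star T)) = -((T - star T) * (T - star T)) := by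
  have hc : X * (T - star T) = (T - star T) * X := by
    rw [mul_sub, sub_mul, h, mul_star_of_commute hX h]
  rw [neg_mul_neg]
  calc X * (T - star T) * (X * (T - star T)) = X * ((T - star T) * X) * (T - star T) := by
        simp only [mul_assoc]
    _ = -((T - star T) * (T - star T)) := by
        rw [← hc, ← mul_assoc, hXX, neg_one_mul, neg_mul]

/-- `L' ι` commutes with `T` and `T*`, while `L' j` exchanges them, fixing `T + T*` and changing the
sign of `T - T*`. Both therefore commute with `T + T*` and `(T - T*)²`, so `commute_pvm` applies;
together with the reals, `ι` and `j` generate `ℍ`. -/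
theorem commute_of_conditions (hι : ι ∈ imaginaryUnits) (hP : IsRealPVM P)
    (hL : ∀ A, MeasurableSet A → ∀ q, Commute (L q) (P A)) (hΓm : MeasurableSet Γ)
    (hΓ : P Γᶜ = 0)
    (hs : TendstoUniformly (fun n => ⇑(s n)) (Γ.indicator fun z => (z : ℍ)) atTop)
    (hT : Tendsto (fun n => specSum P L (s n) (retraction ι)) atTop (𝓝 T))
    (h1 : L' ι * T = T * L' ι) {j : ℍ} (hj : j ∈ imaginaryUnits) (hij : ι * j = -(j * ι))
    (h2 : L' j * T = star T * L' j) {A : Set (halfPlane ι)} (hA : MeasurableSet A) (q : ℍ) :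
    Commute (L' q) (P A) := by
  have hR := tendsto_specSum_re hι hP hL hT
  have hS := tendsto_specSum_imPart hι hP hL hT
  have hLT := commute_of_tendsto_retraction hL hT
  have hSS : ((2⁻¹ : ℝ) • -(L ι * (T - star T))) * ((2⁻¹ : ℝ) • -(L ι * (T - star T))) =
      (2⁻¹ * 2⁻¹ : ℝ) • -((T - star T) * (T - star T)) := by
    rw [smul_mul_smul_comm, neg_mul_sub_star_sq (star_map_of_mem_imaginaryUnits hι)
      (map_mul_self_of_mem_imaginaryUnits hι) hLT]
  have hιc : Commute (P A) (L' ι) := by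
    have h1' := mul_star_of_commute (star_map_of_mem_imaginaryUnits hι) h1
    have c1 : Commute T (L' ι) := h1.symm
    have c2 : Commute (star T) (L' ι) := h1'.symm
    refine commute_pvm hι hP hL hΓm hΓ hs hR hS (star_map_of_mem_imaginaryUnits hι)
      ((c1.add_left c2).smul_left _) ?_ hA
    rw [hSS]
    exact (((c1.sub_left c2).mul_left (c1.sub_left c2)).neg_left).smul_left _
  have hjc : Commute (P A) (L' j) := by
    have h2' : L' j * star T = T * L' j := by
      have hjj := map_mul_self_of_mem_imaginaryUnits (L := L') hj
      calc L' j * star T = -(L' j * (star T * L' j) * L' j) := by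
            rw [mul_assoc, mul_assoc, hjj]; simp
        _ = T * L' j := by
            rw [← h2, ← mul_assoc, hjj]; simp
    have hD : L' j * (T - star T) = -(T - star T) * L' j := by
      rw [mul_sub, h2, h2', neg_sub, sub_mul]
    refine commute_pvm hι hP hL hΓm hΓ hs hR hS (star_map_of_mem_imaginaryUnits hj)
      (Commute.smul_left ?_ _) ?_ hA
    · rw [Commute, SemiconjBy, mul_add, add_mul, h2, h2', add_comm]
    · rw [hSS]
      refine (Commute.neg_left ?_).smul_left _
      rw [Commute, SemiconjBy, ← mul_assoc, hD, mul_assoc, mul_assoc, hD]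
      simp only [neg_mul, mul_neg, neg_neg]
  obtain ⟨x, y, z, w, rfl⟩ := exists_eq_add_mul hι hj hij q
  have hr : ∀ r : ℝ, Commute (L' (r : ℍ)) (P A) := fun r => by
    rw [map_coe_eq_smul]; exact (Commute.one_left _).smul_left _
  rw [map_add, map_mul, map_add, map_add, map_mul, map_mul]
  exact ((hr x).add_left (hιc.symm.mul_left (hr y))).add_left
    (((hr z).add_left (hιc.symm.mul_left (hr w))).mul_left hjc.symm)

/-- The positive operators `-L ι (T - T*)` and `-L' ι (T - T*)` have the same square and commute,
hence coincide. The integral of `imPart` can thus be rewritten with `L'`, and `T` is reassembled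
from its two coordinates. -/
theorem tendsto_of_conditions (hι : ι ∈ imaginaryUnits) (hP : IsRealPVM P)
    (hL : ∀ A, MeasurableSet A → ∀ q, Commute (L q) (P A))
    (hL' : ∀ A, MeasurableSet A → ∀ q, Commute (L' q) (P A))
    (hT : Tendsto (fun n => specSum P L (s n) (retraction ι)) atTop (𝓝 T))
    (h1 : L' ι * T = T * L' ι) (h3 : ∀ u, 0 ≤ inner ℝ u ((-(L' ι * (T - star T))) u)) :
    Tendsto (fun n => specSum P L' (s n) (retraction ι)) atTop (𝓝 T) := by
  have hR := tendsto_specSum_re hι hP hL hT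
  have hS := tendsto_specSum_imPart hι hP hL hT
  have hLT := commute_of_tendsto_retraction hL hT
  have hs1 := star_map_of_mem_imaginaryUnits (L := L) hι
  have hs2 := star_map_of_mem_imaginaryUnits (L := L') hι
  have hm1 := map_mul_self_of_mem_imaginaryUnits (L := L) hι
  have hm2 := map_mul_self_of_mem_imaginaryUnits (L := L') hι
  have hS' : Tendsto (fun n => specSum P L' (s n) (fun q => (imPart ι q : ℍ))) atTop
      (𝓝 ((2⁻¹ : ℝ) • -(L ι * (T - star T)))) := hS.congr fun n => specSum_coe_eq _ _
  have hR' : Tendsto (fun n => specSum P L' (s n) (fun q => (q.re : ℍ))) atTop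
      (𝓝 ((2⁻¹ : ℝ) • (T + star T))) := hR.congr fun n => specSum_coe_eq _ _
  -- Since `L'` commutes with `P`, it commutes with integrals of real functions; this supplies the
  -- commutation needed for uniqueness of the square root.
  have hc' : Commute (L' ι) (-(L ι * (T - star T))) := by
    have : Commute (L' ι) ((2⁻¹ : ℝ) • -(L ι * (T - star T))) :=
      tendsto_nhds_unique (hS'.const_mul (L' ι)) ((hS'.mul_const (L' ι)).congr fun n =>
        (commute_specSum_coe hL' (s n) (imPart ι) ι).eq.symm)
    have h2 := this.smul_right (2 : ℝ)
    rwa [smul_smul, mul_inv_cancel₀ two_ne_zero, one_smul] at h2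
  have hcD : Commute (T - star T) (-(L ι * (T - star T))) := by
    refine Commute.neg_right (Commute.mul_right ?_ rfl)
    rw [Commute, SemiconjBy, sub_mul, mul_sub, hLT, mul_star_of_commute hs1 hLT]
  have heq : -(L ι * (T - star T)) = -(L' ι * (T - star T)) := by
    refine eq_of_sq_eq_of_nonneg (star_neg_mul_sub_star hs1 hLT) (star_neg_mul_sub_star hs2 h1)
      (inner_nonneg_of_tendsto_retraction hι hP hL hT) h3 ?_ ?_
    · exact (hc'.mul_left hcD).neg_left.symm
    · rw [neg_mul_sub_star_sq hs1 hm1 hLT, neg_mul_sub_star_sq hs2 hm2 h1]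
  rw [heq] at hS'
  have hlim := hR'.add (hS'.const_mul (L' ι))
  have e : (2⁻¹ : ℝ) • (T + star T) + L' ι * ((2⁻¹ : ℝ) • -(L' ι * (T - star T))) = T := by
    rw [mul_smul_comm, mul_neg, ← mul_assoc, hm2, neg_one_mul, neg_neg, ← smul_add,
      add_add_sub_cancel, ← two_smul ℝ T, smul_smul]
    norm_num
  rw [e] at hlim
  exact hlim.congr fun n => (specSum_retraction P L' (s n)).symm

end Converse

end HalfPlane

/-! ### Passage between quaternionic and real operators. -/

section Transport

attribute [local instance] realInnerProductSpace

variable {H : Type*} [NormedAddCommGroup H] [QuaternionicHilbertSpace H]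

/-- A quaternionic operator as an operator on the underlying real Hilbert space. -/
noncomputable def toReal : BoundedOp H →+* (H →L[ℝ] H) where
  toFun T :=
    { toFun := T
      map_add' := map_add T
      map_smul' := fun _ x => T.map_smul _ x
      cont := T.continuous }
  map_one' := rfl
  map_mul' _ _ := rfl
  map_zero' := rfl
  map_add' _ _ := rfl

theorem toReal_apply (T : BoundedOp H) (u : H) : toReal T u = T u := rfl

theorem real_inner_eq (u v : H) : inner ℝ u v = (inner ℍ u v).re := rfl

theorem toReal_injective : Function.Injective (toReal (H := H)) := fun _ _ h =>
  ContinuousLinearMap.ext fun u => DFunLike.congr_fun h u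

theorem toReal_adjoint (T : BoundedOp H) : toReal (adjoint T) = star (toReal T) := by
  rw [ContinuousLinearMap.star_eq_adjoint, ContinuousLinearMap.eq_adjoint_iff]
  intro u v
  rw [real_inner_eq, real_inner_eq, toReal_apply, toReal_apply, adjoint_inner_left]

theorem inner_adjoint_right (T : BoundedOp H) (u v : H) :
    inner ℍ u (adjoint T v) = inner ℍ (T u) v := by
  rw [← qinner_conj_symm u, adjoint_inner_left, qinner_conj_symm]

theorem eq_zero_of_mul_eq_star_mul {x : ℍ} (h : ∀ q : ℍ, x * q = star q * x) : x = 0 := by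
  have key : ∀ a b c : ℝ, a * x.imI + b * x.imJ + c * x.imK = 0 ∧ a * x.re = 0 := by
    intro a b c
    obtain ⟨q, q0, q1, q2, q3⟩ : ∃ q : ℍ, q.re = 0 ∧ q.imI = a ∧ q.imJ = b ∧ q.imK = c :=
      ⟨⟨0, a, b, c⟩, rfl, rfl, rfl, rfl⟩
    have h0 := congrArg (·.re) (h q)
    have h1 := congrArg (·.imI) (h q)
    simp [q0, q1, q2, q3] at h0 h1
    constructor <;> linarith
  have h1 := key 1 0 0
  have h2 := key 0 1 0
  have h3 := key 0 0 1
  ext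
  · simp; linarith
  · simp; linarith
  · simp; linarith
  · simp; linarith

/-- Polarizing the reality of `⟨u|Tu⟩` shows that `x = ⟨v|Tu⟩ - ⟨Tv|u⟩` equals `⟨Tu|v⟩ - ⟨u|Tv⟩`.
Replacing `u` by `u q` turns this into `x q = star q * x` for all `q`, which forces `x = 0`. -/
theorem IsPositive.adjoint_eq {T : BoundedOp H} (hT : IsPositive T) : adjoint T = T := by
  have h0 : ∀ u, inner ℍ u (T u) = inner ℍ (T u) u := by
    intro u
    obtain ⟨r, -, hr⟩ := hT u
    rw [← qinner_conj_symm (T u) u, hr, Quaternion.star_coe]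
  have h1 : ∀ u v, inner ℍ u (T v) + inner ℍ v (T u) = inner ℍ (T u) v + inner ℍ (T v) u := by
    intro u v
    have := h0 (u + v)
    rw [map_add, qinner_add_right, qinner_add_left, qinner_add_left, qinner_add_left,
      qinner_add_right, qinner_add_right, h0 u, h0 v] at this
    have e : ∀ a b c d x y : ℍ, a + b + (c + d) = a + x + (y + d) → c + b = x + y := by
      intro a b c d x y h
      have h' : a + d + (c + b) = a + d + (x + y) := by
        calc _ = a + b + (c + d) := by abel
          _ = a + x + (y + d) := h
          _ = _ := by abel
      exact add_left_cancel h'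
    exact e _ _ _ _ _ _ this
  refine ContinuousLinearMap.ext fun v => eq_of_inner_eq fun u => ?_
  rw [adjoint_inner_left, ← sub_eq_zero]
  refine eq_zero_of_mul_eq_star_mul fun q => ?_
  have h2 := h1 v u
  have h3 := h1 v (u <• q)
  rw [map_smul, qinner_smul_right, qinner_smul_left, qinner_smul_right, qinner_smul_left] at h3
  have h4 : inner ℍ v (T u) - inner ℍ (T v) u = inner ℍ (T u) v - inner ℍ u (T v) := by
    rw [sub_eq_sub_iff_add_eq_add, h2, add_comm]
  nth_rw 2 [h4]
  rw [sub_mul, mul_sub, sub_eq_sub_iff_add_eq_add, h3, add_comm]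

theorem isPositive_of_toReal {T : BoundedOp H} (h : star (toReal T) = toReal T)
    (h0 : ∀ u, 0 ≤ inner ℝ u (toReal T u)) : IsPositive T := by
  intro u
  have ha : adjoint T = T := toReal_injective (by rw [toReal_adjoint, h])
  have h1 : star (inner ℍ u (T u)) = inner ℍ u (T u) := by
    rw [qinner_conj_symm, ← adjoint_inner_left, ha]
  refine ⟨(inner ℍ u (T u)).re, h0 u, ?_⟩
  exact (Quaternion.star_eq_self.1 h1)

theorem inner_nonneg_of_isPositive {T : BoundedOp H} (h : IsPositive T) (u : H) :
    0 ≤ inner ℝ u (toReal T u) := by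
  obtain ⟨r, hr, e⟩ := h u
  rw [real_inner_eq, toReal_apply, e]
  exact hr

theorem norm_qinner_le (u v : H) : ‖inner ℍ u v‖ ≤ ‖u‖ * ‖v‖ := by
  set a := inner ℍ u v with ha
  -- Rotating `v` by the conjugate of `a` makes the scalar product the real number `‖a‖²`, so the
  -- real Cauchy–Schwarz inequality suffices.
  have h := real_inner_le_norm u (v <• star a)
  rw [real_inner_eq, qinner_smul_right, ← ha, Quaternion.self_mul_star, Quaternion.re_coe,
    norm_smul_right, norm_star, Quaternion.normSq_eq_norm_mul_self] at h
  rcases (norm_nonneg a).eq_or_lt with h0 | h0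
  · rw [← h0]; positivity
  · exact le_of_mul_le_mul_left (by linarith) h0

theorem continuous_qinner_right (u : H) : Continuous fun v : H => inner ℍ u v :=
  AddMonoidHomClass.continuous_of_bound
    (AddMonoidHom.mk' (fun v : H => inner ℍ u v) (qinner_add_right u)) ‖u‖ (norm_qinner_le u)

/-! ### Left scalar multiplications as star-homomorphisms. -/

section LeftScalarMul

variable {L : ℍ → BoundedOp H} {N : Set H}

theorem IsHilbertBasis.ext (hN : IsHilbertBasis N) {u v : H}
    (h : ∀ z ∈ N, inner ℍ z u = inner ℍ z v) : u = v := by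
  rw [← sub_eq_zero]
  refine hN.perp_eq_zero _ fun z hz => ?_
  have h1 := qinner_add_right z (u - v) v
  rw [sub_add_cancel, h z hz, right_eq_add] at h1
  rw [← qinner_conj_symm, h1, star_zero]

/-- In the coordinates of the basis, `L q` is left multiplication by `q`; the algebraic identities
of `L` are then checked coordinatewise. -/
theorem inner_leftScalarMul (hN : IsHilbertBasis N)
    (hL : ∀ (q : ℍ) (u : H), HasSum (fun z : N => ((z : H) <• q) <• inner ℍ (z : H) u) (L q u))
    (q : ℍ) (u : H) {z : H} (hz : z ∈ N) : inner ℍ z (L q u) = q * inner ℍ z u := by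
  let φ : H →+ ℍ := AddMonoidHom.mk' (fun v => inner ℍ z v) (qinner_add_right z)
  have h1 : HasSum (fun w : N => inner ℍ z (((w : H) <• q) <• inner ℍ (w : H) u))
      (inner ℍ z (L q u)) := (hL q u).map φ (continuous_qinner_right z)
  have h2 := hasSum_single (f := fun w : N => inner ℍ z (((w : H) <• q) <• inner ℍ (w : H) u))
    ⟨z, hz⟩ (fun w hw => by
      rw [qinner_smul_right, qinner_smul_right, hN.orthogonal z hz w w.2
        (fun h => hw (Subtype.ext h.symm)), zero_mul, zero_mul])
  rw [h1.unique h2, qinner_smul_right, qinner_smul_right, qinner_self, hN.norm_eq_one z hz]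
  simp

theorem IsLeftScalarMul.exists_starAlgHom (hL : IsLeftScalarMul L) :
    ∃ 𝓛 : ℍ →⋆ₐ[ℝ] (H →L[ℝ] H), ∀ q, 𝓛 q = toReal (L q) := by
  obtain ⟨N, hN, hLN⟩ := hL
  have key : ∀ (q : ℍ) (u z : H), z ∈ N → inner ℍ z (L q u) = q * inner ℍ z u :=
    fun q u z hz => inner_leftScalarMul hN hLN q u hz
  have hcoe : ∀ r : ℝ, toReal (L (r : ℍ)) = algebraMap ℝ (H →L[ℝ] H) r := fun r => by
    ext u
    rw [toReal_apply, Algebra.algebraMap_eq_smul_one]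
    change L r u = u <• (r : ℍ)
    refine hN.ext fun z hz => ?_
    rw [key _ _ _ hz, qinner_smul_right, Quaternion.coe_commutes]
  have hmul : ∀ p q, L (p * q) = L p * L q := fun p q => by
    refine ContinuousLinearMap.ext fun u => hN.ext fun z hz => ?_
    rw [mul_apply_eq_comp, key _ _ _ hz, key _ _ _ hz, key _ _ _ hz, mul_assoc]
  have hadd : ∀ p q, L (p + q) = L p + L q := fun p q => by
    refine ContinuousLinearMap.ext fun u => hN.ext fun z hz => ?_
    rw [add_apply, qinner_add_right, key _ _ _ hz, key _ _ _ hz, key _ _ _ hz,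
      add_mul]
  have hz' : ∀ (q : ℍ) (z : H), z ∈ N → L q z = z <• q := fun q z hz => by
    refine hN.ext fun w hw => ?_
    rw [key _ _ _ hw, qinner_smul_right]
    by_cases h : w = z
    · rw [h, qinner_self, Quaternion.coe_commutes]
    · rw [hN.orthogonal w hw z hz h, zero_mul, mul_zero]
  have hstar : ∀ q, L (star q) = adjoint (L q) := fun q => by
    refine ContinuousLinearMap.ext fun u => hN.ext fun z hz => ?_
    rw [key _ _ _ hz, inner_adjoint_right, hz' q z hz, qinner_smul_left]
  refine ⟨{ toFun := fun q => toReal (L q)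
            map_one' := by
              have := hcoe 1
              rwa [Quaternion.coe_one, map_one] at this
            map_mul' := fun p q => by rw [hmul, map_mul]
            map_zero' := by
              have := hcoe 0
              rwa [Quaternion.coe_zero, map_zero] at this
            map_add' := fun p q => by rw [hadd, map_add]
            commutes' := hcoe
            map_star' := fun q => by rw [hstar, toReal_adjoint] }, fun q => rfl⟩

end LeftScalarMul

/-! ### The two implications for quaternionic projection-valued measures. -/

section PVM

variable {ι : ℍ} {P : Set (halfPlane ι) → BoundedOp H} {L : ℍ → BoundedOp H}
  {𝓛 : ℍ →⋆ₐ[ℝ] (H →L[ℝ] H)}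

theorem IsQPVM.isRealPVM (hP : IsQPVM P) : IsRealPVM (fun A => toReal (P A)) where
  univ := by rw [hP.univ, map_one]
  empty := by
    -- Additivity over the empty index set gives `P ∅ = 0`.
    have h := fun u => hP.sigma_additive ∅ (fun _ => ∅) (fun _ => MeasurableSet.empty)
      (fun n => n.2.elim) u
    have h0 : P ∅ = 0 := by
      refine ContinuousLinearMap.ext fun u => ?_
      have h1 := h u
      rw [Set.iUnion_empty] at h1
      exact h1.unique hasSum_empty
    rw [h0, map_zero]
  inter A B hA hB := by rw [← map_mul, hP.inter A B hA hB]
  iUnion A hA hd u := by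
    have h := hP.sigma_additive Set.univ (fun n => A n) (fun n => hA n)
      (fun n m hnm => hd (fun h => hnm (Subtype.ext h))) u
    have hU : ⋃ n : (Set.univ : Set ℕ), A n = ⋃ n, A n := by simp
    rw [hU] at h
    exact (Equiv.hasSum_iff (Equiv.Set.univ ℕ) (f := fun n => P (A n) u)).1 h
  star_eq A hA := by rw [← toReal_adjoint, (hP.positive A hA).adjoint_eq]

theorem toReal_simpleIntegral (h𝓛 : ∀ q, 𝓛 q = toReal (L q)) (s : SimpleFunc (halfPlane ι) ℍ) :
    toReal (simpleIntegral P L s) = specSum (fun A => toReal (P A)) 𝓛 s id := by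
  simp only [simpleIntegral, specSum, map_sum, map_mul, h𝓛, id]

theorem tendstoInOpNorm_iff {S : ℕ → BoundedOp H} {T : BoundedOp H} :
    TendstoInOpNorm S T ↔ Tendsto (fun n => toReal (S n)) atTop (𝓝 (toReal T)) := by
  constructor
  · intro h
    rw [Metric.tendsto_atTop]
    intro ε hε
    obtain ⟨n₀, hn⟩ := h (ε / 2) (by positivity)
    refine ⟨n₀, fun n hn' => ?_⟩
    rw [dist_eq_norm]
    refine lt_of_le_of_lt (b := ε / 2) ?_ (by linarith)
    exact ContinuousLinearMap.opNorm_le_bound _ (by positivity) fun u => hn n hn' u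
  · intro h ε hε
    obtain ⟨n₀, hn⟩ := Metric.tendsto_atTop.1 h ε hε
    refine ⟨n₀, fun n hn' u => ?_⟩
    have h1 := hn n hn'
    rw [dist_eq_norm] at h1
    exact (ContinuousLinearMap.le_opNorm (toReal (S n) - toReal T) u).trans (by gcongr)

theorem measurableSet_pvmSupport : MeasurableSet (pvmSupport P) :=
  (isOpen_sUnion fun _ hO => hO.1).measurableSet.compl

theorem toReal_compl_pvmSupport (hP : IsQPVM P) : toReal (P (pvmSupport P)ᶜ) = 0 := by
  have : SecondCountableTopology ℍ := secondCountable_of_proper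
  have h := hP.isRealPVM.sUnion_open_eq_zero
  simp only [map_eq_zero_iff _ (toReal_injective (H := H))] at h
  rw [pvmSupport, compl_compl, h, map_zero]

theorem IsIQPVM.commute_toReal (h : IsIQPVM P L) (h𝓛 : ∀ q, 𝓛 q = toReal (L q))
    (A : Set (halfPlane ι)) (hA : MeasurableSet A) (q : ℍ) :
    Commute (𝓛 q) (toReal (P A)) := by
  rw [h𝓛, Commute, SemiconjBy, ← map_mul, ← map_mul, h.commute A q hA]

theorem tendsto_retraction_of_integral (hι : ι ∈ imaginaryUnits) (h : IsIQPVM P L)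
    (h𝓛 : ∀ q, 𝓛 q = toReal (L q)) {T : BoundedOp H} {s : ℕ → SimpleFunc (halfPlane ι) ℍ}
    (hs : TendstoUniformly (fun n => ⇑(s n)) ((pvmSupport P).indicator fun z => (z : ℍ)) atTop)
    (hT : TendstoInOpNorm (fun n => simpleIntegral P L (s n)) T) :
    Tendsto (fun n => specSum (fun A => toReal (P A)) 𝓛 (s n) (retraction ι)) atTop
      (𝓝 (toReal T)) := by
  rw [tendstoInOpNorm_iff] at hT
  simp only [toReal_simpleIntegral h𝓛] at hT
  have := hT.sub (tendsto_specSum_sub_retraction hι h.isQPVM.isRealPVM (h.commute_toReal h𝓛) hs)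
  simpa using this

theorem conditions_of_hasIntegral (hι : ι ∈ imaginaryUnits) {T : BoundedOp H} (h : IsIQPVM P L)
    (hT : HasIntegral P L (fun z => (z : ℍ)) T) :
    L ι * T = T * L ι ∧
      (∃ j ∈ imaginaryUnits, ι * j = -(j * ι) ∧ L j * T = adjoint T * L j) ∧
      IsPositive (-(L ι * (T - adjoint T))) := by
  obtain ⟨𝓛, h𝓛⟩ := h.isLeftScalarMul.exists_starAlgHom
  obtain ⟨s, hs, hsT⟩ := hT
  have hP := h.isQPVM.isRealPVM
  have hc := h.commute_toReal h𝓛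
  have hlim := tendsto_retraction_of_integral hι h h𝓛 hs hsT
  have h1 := commute_of_tendsto_retraction hc hlim
  have e : toReal (-(L ι * (T - adjoint T))) = -(𝓛 ι * (toReal T - star (toReal T))) := by
    rw [map_neg, map_mul, map_sub, toReal_adjoint, h𝓛]
  refine ⟨toReal_injective (by rw [map_mul, map_mul, ← h𝓛, h1]), ?_, ?_⟩
  · obtain ⟨j, hj, hij⟩ := exists_anticommuting_unit hι
    refine ⟨j, hj, hij, toReal_injective ?_⟩
    rw [map_mul, map_mul, toReal_adjoint, ← h𝓛]
    exact mul_eq_star_mul_of_tendsto_retraction hι hP hc hlim hij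
  · refine isPositive_of_toReal ?_ ?_
    · rw [e]
      exact star_neg_mul_sub_star (star_map_of_mem_imaginaryUnits hι) h1
    · rw [e]
      exact inner_nonneg_of_tendsto_retraction hι hP hc hlim

theorem hasIntegral_of_conditions (hι : ι ∈ imaginaryUnits) {T : BoundedOp H}
    (hPT : IsAssociatedQPVM P T) (hL : IsLeftScalarMul L) (h1 : L ι * T = T * L ι) {j : ℍ}
    (hj : j ∈ imaginaryUnits) (hij : ι * j = -(j * ι)) (h2 : L j * T = adjoint T * L j)
    (h3 : IsPositive (-(L ι * (T - adjoint T)))) :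
    IsIQPVM P L ∧ HasIntegral P L (fun z => (z : ℍ)) T := by
  obtain ⟨-, L₀, h₀, s, hs, hsT⟩ := hPT
  obtain ⟨𝓛₀, h𝓛₀⟩ := h₀.isLeftScalarMul.exists_starAlgHom
  obtain ⟨𝓛, h𝓛⟩ := hL.exists_starAlgHom
  have hP := h₀.isQPVM.isRealPVM
  have hc₀ := h₀.commute_toReal h𝓛₀
  have hlim := tendsto_retraction_of_integral hι h₀ h𝓛₀ hs hsT
  have h1' : 𝓛 ι * toReal T = toReal T * 𝓛 ι := by rw [h𝓛, ← map_mul, h1, map_mul]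
  have h2' : 𝓛 j * toReal T = star (toReal T) * 𝓛 j := by
    rw [h𝓛, ← map_mul, h2, map_mul, toReal_adjoint]
  have e : toReal (-(L ι * (T - adjoint T))) = -(𝓛 ι * (toReal T - star (toReal T))) := by
    rw [map_neg, map_mul, map_sub, toReal_adjoint, h𝓛]
  have hc : ∀ A, MeasurableSet A → ∀ q, Commute (𝓛 q) (toReal (P A)) := fun A hA q =>
    commute_of_conditions hι hP hc₀ measurableSet_pvmSupport
      (toReal_compl_pvmSupport h₀.isQPVM) hs hlim h1' hj hij h2' hA q
  have hlim' := tendsto_of_conditions hι hP hc₀ hc hlim h1'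
    (fun u => e ▸ inner_nonneg_of_isPositive h3 u)
  -- The support depends only on `P`, so the simple functions chosen for `L₀` also serve for `L`.
  refine ⟨⟨h₀.isQPVM, hL, fun A q hA => toReal_injective ?_⟩, s, hs, ?_⟩
  · rw [map_mul, map_mul, ← h𝓛, (hc A hA q).eq]
  · rw [tendstoInOpNorm_iff]
    simp only [toReal_simpleIntegral h𝓛]
    have := (tendsto_specSum_sub_retraction hι hP hc hs).add hlim'
    simpa using this

end PVM

end Transport

end QuaternionicSpectral

theorem mainTheorem2 {H : Type*} [NormedAddCommGroup H] [QuaternionicHilbertSpace H] [Nontrivial H]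
    (ι : ℍ) (hι : ι ∈ imaginaryUnits)
    (T : BoundedOp H) (hT : IsNormal T)
    (P : Set (halfPlane ι) → BoundedOp H) (hP : IsAssociatedQPVM P T)
    (L : ℍ → BoundedOp H) (hL : IsLeftScalarMul L) :
    (IsIQPVM P L ∧ HasIntegral P L (fun z => (z : ℍ)) T) ↔
      (L ι * T = T * L ι ∧
        (∃ j ∈ imaginaryUnits, ι * j = -(j * ι) ∧ L j * T = adjoint T * L j) ∧
        IsPositive (-(L ι * (T - adjoint T)))) :=
  ⟨fun h => conditions_of_hasIntegral hι h.1 h.2, fun ⟨h1, ⟨_, hj, hij, h2⟩, h3⟩ =>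
    hasIntegral_of_conditions hι hP hL h1 hj hij h2 h3⟩
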